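/- Let $F$ be a field of characteristic different from $3$ containing a primitive cube root of unity $\rho$, let $\bar F$ be an algebraic closure of $F$, and let $r,e,t,\alpha,\beta,\gamma,\delta\in F$ with $\alpha\neq 0$. Put $$\Phi=Z^3-rYZ^2-(eXY+tY^2)Z-(\alpha X^3+\beta X^2Y+\gamma XY^2+\delta Y^3),$$ and let $C_\Phi$ be the quotient of the free associative algebra $F\{x,y\}$ by the two-sided ideal generated by the elements $\Phi(ax+by,a,b)$ (with $Z=ax+by$, $X=a$, $Y=b$) for all $a,b\in F$. Set $$D_1=\gamma+\frac{er}{3}-\frac{\beta^2}{3\alpha},\qquad D_2=e\beta-3\alpha t-\alpha r^2,\qquad D=\frac{e^3}{27\alpha}+\frac{\beta^3}{27\alpha^2}-\frac{2r^3}{27}+\frac{\beta}{3\alpha}D_1-\frac{rt}{3}-\delta,$$ and let $E$ be the affine curve $$E\colon\ (D-\rho^2eR)S+S^2+\alpha R^3-\frac{D_1^3}{27\alpha}-\frac{D_2^3}{729\alpha^3}-\rho^2\frac{D_1D_2}{9\alpha}R=0 .$$ Assume that the discriminant of $E$ (that is, of its Weierstrass equation in the coordinates $-\alpha R,\ \alpha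 S$) is nonzero, that $D\neq 0$, and that $F[x:x^3=\alpha]\cong F[T]/(T^3-\alpha)$ is a field. In $C_\Phi$ (where $x^{-1}=\alpha^{-1}x^2$) put $y_k=\frac13\sum_{j=0}^{2}\rho^{kj}x^jyx^{-j}$ for $k=1,2$, and $w=x^{-1}y_2y_1+\rho^2\frac{D_1}{3\alpha}x+\frac{D_2}{9\alpha}x^{-1}$. For a field $L\supseteq F$ and $a,b\in L^\times$ let $(a,b)_{3,L}$ be the $L$-algebra with generators $u,v$ and relations $u^3=a$, $v^3=b$, $vu=\rho uv$. Then there is a one-to-one correspondence between the orbits of $\mathrm{Aut}(\bar F/F)$ on the $\bar F$-points of $E$ and the simple homomorphic images of $C_\Phi$ (that is, its simple quotients by two-sided ideals), such that for every $\bar F$-point $(R_0,S_0)$ of $E$ the simple image attached to its orbit is isomorphic as an $F$-algebra, by an isomorphism sending the classes of $w$ and $y_1^3$ to $R_0$ and $S_0$ respectively, to the following central simple $F(R_0,S_0)$-algebra: * $(\alpha,S_0)_{3,F(R_0,S_0)}$ if $S_0\neq 0$; * $(\rho^2eR_0-D,\ \alpha)_{3,F(R_0,S_0)}$ if $S_0=0$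 (and then $\rho^2eR_0-D\neq 0$). -/

import Mathlib

open scoped Polynomial IntermediateField

noncomputable section

/-- Defining relations of the generalized Clifford algebra of `Φ ∈ F[X₁,…,Xₙ][Z]`: for all scalars
`a₁,…,aₙ`, the element `a₁x₁ + ⋯ + aₙxₙ` is a root of the polynomial `Φ(Z,a₁,…,aₙ)`. -/
inductive GenCliffordRel {F : Type*} [Field F] {n : ℕ} (Φ : Polynomial (MvPolynomial (Fin n) F)) :
    FreeAlgebra F (Fin n) → FreeAlgebra F (Fin n) → Prop
  | root (a : Fin n → F) :
      GenCliffordRel Φ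
        (Polynomial.aeval (∑ i, a i • FreeAlgebra.ι F i) (Φ.map (MvPolynomial.eval a))) 0

/-- The generalized Clifford algebra `C_Φ`. -/
abbrev GenClifford {F : Type*} [Field F] {n : ℕ} (Φ : Polynomial (MvPolynomial (Fin n) F)) :=
  RingQuot (GenCliffordRel Φ)

/-- The generator `xᵢ` of `C_Φ`. -/
def GenClifford.gen {F : Type*} [Field F] {n : ℕ} (Φ : Polynomial (MvPolynomial (Fin n) F))
    (i : Fin n) : GenClifford Φ :=
  RingQuot.mkAlgHom F (GenCliffordRel Φ) (FreeAlgebra.ι F i)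

/-- Defining relations of the symbol algebra, with generators `x = ι 0` and `y = ι 1`:
`x ^ d = a`, `y ^ d = b`, `y x = ζ x y`. -/
inductive SymbolRel {L : Type*} [Field L] (d : ℕ) (ζ a b : L) :
    FreeAlgebra L (Fin 2) → FreeAlgebra L (Fin 2) → Prop
  | pow_fst : SymbolRel d ζ a b (FreeAlgebra.ι L 0 ^ d) (algebraMap L _ a)
  | pow_snd : SymbolRel d ζ a b (FreeAlgebra.ι L 1 ^ d) (algebraMap L _ b)
  | comm : SymbolRel d ζ a b (FreeAlgebra.ι L 1 * FreeAlgebra.ι L 0)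
      (ζ • (FreeAlgebra.ι L 0 * FreeAlgebra.ι L 1))

/-- The symbol algebra `(a,b)_{d,L}` with respect to the root of unity `ζ`. -/
abbrev SymbolAlgebra {L : Type*} [Field L] (d : ℕ) (ζ a b : L) := RingQuot (SymbolRel d ζ a b)

/-- `A` is a central simple `L`-algebra (finite-dimensional over `L`, as usual). -/
def IsCentralSimple (L A : Type*) [Field L] [Ring A] [Algebra L A] : Prop :=
  Algebra.IsCentral L A ∧ IsSimpleRing A ∧ FiniteDimensional L A

/-- The simple homomorphic images of a ring, taken as its simple quotients by two-sided ideals. -/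
abbrev SimpleImage (A : Type*) [Ring A] :=
  {I : TwoSidedIdeal A // IsSimpleRing I.ringCon.Quotient}

/-- The coefficients of
`Φ = Z³ - r Y Z² - (e X Y + t Y²) Z - (α X³ + β X² Y + γ X Y² + δ Y³)`. -/
structure CubicCoeffs (F : Type*) where
  (r e t α β γ δ : F)

namespace CubicCoeffs

variable {F : Type*} [Field F] (c : CubicCoeffs F)

/-- The polynomial `Φ ∈ F[X,Y][Z]`, where `X` and `Y` are the variables `0` and `1` of the
coefficient ring. -/
def Φ : Polynomial (MvPolynomial (Fin 2) F) :=
  let X : MvPolynomial (Fin 2) F := MvPolynomial.X 0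
  let Y : MvPolynomial (Fin 2) F := MvPolynomial.X 1
  let k : F → MvPolynomial (Fin 2) F := fun a => MvPolynomial.C a
  Polynomial.X ^ 3 - Polynomial.C (k c.r * Y) * Polynomial.X ^ 2
    - Polynomial.C (k c.e * X * Y + k c.t * Y ^ 2) * Polynomial.X
    - Polynomial.C (k c.α * X ^ 3 + k c.β * X ^ 2 * Y + k c.γ * X * Y ^ 2 + k c.δ * Y ^ 3)

def D₁ : F := c.γ + c.e * c.r / 3 - c.β ^ 2 / (3 * c.α)

def D₂ : F := c.e * c.β - 3 * c.α * c.t - c.α * c.r ^ 2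

def D : F :=
  c.e ^ 3 / (27 * c.α) + c.β ^ 3 / (27 * c.α ^ 2) - 2 * c.r ^ 3 / 27
    + c.β / (3 * c.α) * c.D₁ - c.r * c.t / 3 - c.δ

/-- The generator `x` of `C_Φ`. -/
def x : GenClifford c.Φ := GenClifford.gen c.Φ 0

/-- The generator `y` of `C_Φ`. -/
def y : GenClifford c.Φ := GenClifford.gen c.Φ 1

/-- The inverse of `x`, as `x ^ 3 = α`. -/
def xInv : GenClifford c.Φ := c.α⁻¹ • c.x ^ 2

/-- The component `yₖ = (1/3) ∑ⱼ ρ^(kj) xʲ y x⁻ʲ` of `y` that satisfies `yₖ x = ρᵏ x yₖ`. -/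
def yComp (ρ : F) (k : ℕ) : GenClifford c.Φ :=
  (3 : F)⁻¹ • ∑ j ∈ Finset.range 3, ρ ^ (k * j) • (c.x ^ j * c.y * c.xInv ^ j)

/-- The element `w = x⁻¹ y₂ y₁ + ρ² D₁/(3α) x + D₂/(9α) x⁻¹`. -/
def w (ρ : F) : GenClifford c.Φ :=
  c.xInv * c.yComp ρ 2 * c.yComp ρ 1 + (ρ ^ 2 * (c.D₁ / (3 * c.α))) • c.x
    + (c.D₂ / (9 * c.α)) • c.xInv

/-- The left-hand side of the equation of the affine curve
`E : (D - ρ² e R) S + S² + α R³ - D₁³/(27α) - D₂³/(729α³) - ρ² D₁D₂/(9α) R = 0`. -/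
def curveEq (ρ : F) {K : Type*} [Field K] [Algebra F K] (R S : K) : K :=
  (algebraMap F K c.D - algebraMap F K (ρ ^ 2 * c.e) * R) * S + S ^ 2
    + algebraMap F K c.α * R ^ 3
    - algebraMap F K (c.D₁ ^ 3 / (27 * c.α)) - algebraMap F K (c.D₂ ^ 3 / (729 * c.α ^ 3))
    - algebraMap F K (ρ ^ 2 * (c.D₁ * c.D₂ / (9 * c.α))) * R

/-- The Weierstrass form of `E`, in the coordinates `-α R`, `α S`. -/
def weierstrass (ρ : F) : WeierstrassCurve F where
  a₁ := ρ ^ 2 * c.e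
  a₂ := 0
  a₃ := c.α * c.D
  a₄ := -(ρ ^ 2 * c.D₁ * c.D₂ / 9)
  a₆ := c.α * c.D₁ ^ 3 / 27 + c.D₂ ^ 3 / (729 * c.α)

theorem weierstrass_equation_iff (ρ : F) (hα : c.α ≠ 0) (h3 : (3 : F) ≠ 0) (R S : F) :
    (c.weierstrass ρ).toAffine.Equation (-(c.α * R)) (c.α * S) ↔ c.curveEq ρ R S = 0 := by
  have h9 : (9 : F) ≠ 0 := by
    have h : (9 : F) = 3 ^ 2 := by norm_num
    rw [h]; exact pow_ne_zero _ h3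
  have h27 : (27 : F) ≠ 0 := by
    have h : (27 : F) = 3 ^ 3 := by norm_num
    rw [h]; exact pow_ne_zero _ h3
  have h729 : (729 : F) ≠ 0 := by
    have h : (729 : F) = 3 ^ 6 := by norm_num
    rw [h]; exact pow_ne_zero _ h3
  rw [WeierstrassCurve.Affine.equation_iff, ← sub_eq_zero]
  have key : (c.α * S) ^ 2 + (c.weierstrass ρ).a₁ * (-(c.α * R)) * (c.α * S)
      + (c.weierstrass ρ).a₃ * (c.α * S) - ((-(c.α * R)) ^ 3
      + (c.weierstrass ρ).a₂ * (-(c.α * R)) ^ 2 + (c.weierstrass ρ).a₄ * (-(c.α * R))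
      + (c.weierstrass ρ).a₆) = c.α ^ 2 * c.curveEq ρ R S := by
    simp only [weierstrass, curveEq, Algebra.algebraMap_self, RingHom.id_apply]
    field_simp
    ring
  simp only [WeierstrassCurve.toAffine] at key ⊢
  rw [key]
  simp [hα]

/-- The `F̄`-rational points of the affine curve `E`. -/
def Point (ρ : F) : Type _ :=
  {P : AlgebraicClosure F × AlgebraicClosure F // c.curveEq ρ P.1 P.2 = 0}

variable {c} in
def Point.R {ρ : F} (P : c.Point ρ) : AlgebraicClosure F := P.1.1

variable {c} in
def Point.S {ρ : F} (P : c.Point ρ) : AlgebraicClosure F := P.1.2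

variable {c} in
theorem curveEq_map {ρ : F} (σ : AlgebraicClosure F ≃ₐ[F] AlgebraicClosure F)
    (R S : AlgebraicClosure F) : c.curveEq ρ (σ R) (σ S) = σ (c.curveEq ρ R S) := by
  simp only [curveEq, map_add, map_sub, map_mul, map_pow, AlgEquiv.commutes]

/-- The coordinatewise action of `Aut(F̄/F)` on the points of `E`. -/
instance (ρ : F) : MulAction (AlgebraicClosure F ≃ₐ[F] AlgebraicClosure F) (c.Point ρ) where
  smul σ P := ⟨(σ P.R, σ P.S), by
    have h : c.curveEq ρ P.R P.S = 0 := P.2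
    rw [curveEq_map, h, map_zero]⟩
  one_smul _ := rfl
  mul_smul _ _ _ := rfl

/-- The Galois orbits of `F̄`-rational points of `E`. -/
abbrev GaloisOrbit (ρ : F) :=
  MulAction.orbitRel.Quotient (AlgebraicClosure F ≃ₐ[F] AlgebraicClosure F) (c.Point ρ)

variable {c}

/-- The Galois orbit of a point. -/
def Point.orbit {ρ : F} (P : c.Point ρ) : c.GaloisOrbit ρ :=
  Quotient.mk (MulAction.orbitRel _ _) P

/-- The residue field `F(R₀,S₀)` of a point. -/
abbrev Point.field {ρ : F} (P : c.Point ρ) : IntermediateField F (AlgebraicClosure F) :=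
  F⟮P.R, P.S⟯

/-- The coordinate `R₀` as an element of `F(R₀,S₀)`. -/
def Point.R₀ {ρ : F} (P : c.Point ρ) : P.field :=
  ⟨P.R, IntermediateField.subset_adjoin F _ (Set.mem_insert _ _)⟩

/-- The coordinate `S₀` as an element of `F(R₀,S₀)`. -/
def Point.S₀ {ρ : F} (P : c.Point ρ) : P.field :=
  ⟨P.S, IntermediateField.subset_adjoin F _ (Set.mem_insert_of_mem _ rfl)⟩

/-- The algebra `(α, S₀)_{3,F(R₀,S₀)}`. -/
abbrev Point.algOne {ρ : F} (P : c.Point ρ) :=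
  SymbolAlgebra 3 (algebraMap F P.field ρ) (algebraMap F P.field c.α) P.S₀

/-- The algebra `(ρ² e R₀ - D, α)_{3,F(R₀,S₀)}`. -/
abbrev Point.algTwo {ρ : F} (P : c.Point ρ) :=
  SymbolAlgebra 3 (algebraMap F P.field ρ)
    (algebraMap F P.field (ρ ^ 2 * c.e) * P.R₀ - algebraMap F P.field c.D)
    (algebraMap F P.field c.α)

/-- The simple image `C_Φ / I` is isomorphic to `A` over `F` in such a way that the classes of
`w` and `y₁³` go to the scalars `R₀` and `S₀`. -/
def Point.Yields {ρ : F} (P : c.Point ρ) (I : SimpleImage (GenClifford c.Φ))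
    (A : Type*) [Ring A] [Algebra F A] [Algebra P.field A] : Prop :=
  ∃ φ : I.1.ringCon.Quotient ≃ₐ[F] A,
    φ ((c.w ρ : GenClifford c.Φ) : I.1.ringCon.Quotient) = algebraMap P.field A P.R₀ ∧
    φ ((c.yComp ρ 1 ^ 3 : GenClifford c.Φ) : I.1.ringCon.Quotient) = algebraMap P.field A P.S₀

end CubicCoeffs

end

/-!
Write `y₀`, `y₁`, `y₂` for the components of `y` under conjugation by `x`, so that `yₖ x = ρᵏ x yₖ`.
As `F` contains `0`, `1`, `ρ`, the relations of `C_Φ` are the four coefficient identities of the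
form `Φ(ax + by, a, b)`: one says `x³ = α`, the next expresses `y₀` through `x`, the third gives
`y₁ y₂ = ρ y₂ y₁ + g(x)`, and the last becomes `y₁³ + y₂³ = ρ² e w - D`
(`CliffordPair.isGradedTriple` and its converse `IsGradedTriple.cliffordPair`). In this presentation
`w` and `s = y₁³` are central and `y₂ y₁ = h(x)` for `h(X) = w X - p X² - q`. Hence
`y₂³ y₁³ = h(x) h(ρ x) h(ρ² x)`, the norm of `h(x)`, and this is exactly the equation of `E` for
`(w, s)` (`mul_pow_three_eq`, `curveEq_eq`).

Simple image to point: `C_Φ` is spanned over `F[w, s]` by the `xⁱ y₁ʲ` and `xⁱ y₂ʲ`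
(`finite_of_graded`), so in a simple image the centre, which is a field, is integral over the image
of `F[w, s]`. That image is therefore a field, finite over `F` by the Nullstellensatz, and embeds
into the algebraic closure: `(w, s)` becomes a point of `E` (`exists_point_of_isSimpleRing`).

Point to simple image: let `(R₀, S₀)` be a point with residue field `K` and `T₀ = ρ² e R₀ - D - S₀`.
If `S₀ ≠ 0`, then `y₂ = h(x) y₁⁻¹`, and an algebra in which `w = R₀` and `y₁³ = S₀` is generated
over `K` by `x` and `y₁`, so it is a quotient of `(α, S₀)`. If `S₀ = 0` and `T₀ ≠ 0`, then
`y₁ = y₂⁻¹ h(x)`, and it is a quotient of `(T₀, α)`. The symbol algebras do satisfy the relations of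
`C_Φ`, and they are central simple (`isCentralSimple_of_symbol`), so in either case there is exactly
one simple image over the point (`Point.exists_image_of_model`). Finally `S₀ = T₀ = 0` is
impossible: it would make `R₀ = D / (ρ² e)` a nonzero element of `F` for which the norm of `h(x)`
from the cubic field `F[x : x³ = α]` vanishes, forcing `h(x) = 0` (`cubicNorm_ne_zero`).

Two points give the same simple image iff their coordinates satisfy the same polynomials over `F`,
that is, iff they are conjugate (`LiesUnder.orbit_eq`, `LiesUnder.of_orbit_eq`).
-/

universe u

/-! ### The relations of the algebra in terms of graded components -/

section
variable {F A : Type*} [Field F] [Ring A] [Algebra F A]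

theorem skew_mul_assoc {ρ : F} {x y : A} (h : y * x = ρ • (x * y)) (a : A) :
    y * (x * a) = ρ • (x * (y * a)) := by
  rw [← mul_assoc, h, smul_mul_assoc, mul_assoc]

theorem cube_assoc {α : F} {x : A} (hx : x * (x * x) = α • (1 : A)) (a : A) :
    x * (x * (x * a)) = α • a := by
  rw [← mul_assoc x x a, ← mul_assoc x, hx, smul_mul_assoc, one_mul]

/-- If the degree `0` part of `y` is `a₀ + a₁ x + a₂ x²`, the relation of `C_Φ` of bidegree `(2, 1)`
holds when `r`, `e`, `β` are `3 a₀`, `3 α a₂`, `3 α a₁`. -/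
theorem xxy_eq_zero {ρ α a₀ a₁ a₂ : F} {x y₁ y₂ : A}
    (hρ : ρ ^ 2 + ρ + 1 = 0)
    (hx : x * (x * x) = α • (1 : A)) (h₁ : y₁ * x = ρ • (x * y₁))
    (h₂ : y₂ * x = ρ ^ 2 • (x * y₂)) {y : A}
    (hy : y = a₀ • (1 : A) + a₁ • x + a₂ • (x * x) + y₁ + y₂) :
    x ^ 2 * y + x * y * x + y * x ^ 2 - (3 * a₀) • x ^ 2 - (3 * α * a₂) • x - (3 * α * a₁) • (1 : A)
      = 0 := by
  subst hy
  simp only [pow_two x, mul_add, add_mul, smul_mul_assoc, mul_smul_comm, mul_assoc, hx,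
    h₁, skew_mul_assoc h₁, h₂, skew_mul_assoc h₂, mul_one, one_mul, smul_smul]
  have e : ρ ^ 2 = - ρ - 1 := by linear_combination hρ
  match_scalars <;> grind

/-- The relation of bidegree `(1, 2)`, expanded in graded components. Its parts of degrees `1` and
`2` cancel, and only the commutation rule between `y₁` and `y₂` is left. The coefficients of `x` and
`1` are `t` and `γ`, rewritten in terms of `a₀`, `a₁`, `a₂`, `p`, `q`. -/
theorem xyy_eq {ρ α a₀ a₁ a₂ p q : F} {x y₁ y₂ : A}
    (hρ : ρ ^ 2 + ρ + 1 = 0)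
    (hx : x * (x * x) = α • (1 : A)) (h₁ : y₁ * x = ρ • (x * y₁))
    (h₂ : y₂ * x = ρ ^ 2 • (x * y₂)) {y : A}
    (hy : y = a₀ • (1 : A) + a₁ • x + a₂ • (x * x) + y₁ + y₂) :
    x * y ^ 2 + y * x * y + y ^ 2 * x - (3 * a₀) • (x * y + y * x) - (3 * α * a₂) • y
        - (3 * α * a₁ * a₂ - 3 * a₀ ^ 2 - 3 * q) • x
        - (3 * α * ρ * p - 3 * α * a₀ * a₂ + 3 * α * a₁ ^ 2) • (1 : A)
      = (1 - ρ ^ 2) • (x * (y₁ * y₂ - ρ • (y₂ * y₁) - (p * (ρ - ρ ^ 2)) • (x * x)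
        - (q * (ρ - 1)) • (1 : A))) := by
  subst hy
  simp only [pow_two (_ + _ : A), mul_add, add_mul, mul_sub, smul_mul_assoc, mul_smul_comm,
    mul_assoc, hx, cube_assoc hx, h₁, skew_mul_assoc h₁, h₂, skew_mul_assoc h₂, mul_one, one_mul,
    smul_smul, smul_add, smul_sub]
  have e : ρ ^ 2 = - ρ - 1 := by linear_combination hρ
  match_scalars <;> grind

/-- The relation of bidegree `(0, 3)`, expanded in graded components modulo the commutation rule
between `y₁` and `y₂`: only the rule for `y₁ ^ 3 + y₂ ^ 3` is left. The last coefficient is `δ`. -/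
theorem yyy_eq {ρ α a₀ a₁ a₂ p q d : F} {x y₁ y₂ : A}
    (hρ : ρ ^ 2 + ρ + 1 = 0)
    (hx : x * (x * x) = α • (1 : A)) (h₁ : y₁ * x = ρ • (x * y₁)) (h₂ : y₂ * x = ρ ^ 2 • (x * y₂))
    (h₁₂ : y₁ * y₂ = ρ • (y₂ * y₁) + (p * (ρ - ρ ^ 2)) • (x * x) + (q * (ρ - 1)) • (1 : A)) {y : A}
    (hy : y = a₀ • (1 : A) + a₁ • x + a₂ • (x * x) + y₁ + y₂) :
    y ^ 3 - (3 * a₀) • y ^ 2 - (3 * α * a₁ * a₂ - 3 * a₀ ^ 2 - 3 * q) • y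
       - (α ^ 2 * a₂ ^ 3 + α * a₁ ^ 3 - 2 * a₀ ^ 3 + a₁ * (3 * α * ρ * p)
          - a₀ * (3 * α * a₁ * a₂ - 3 * a₀ ^ 2 - 3 * q) - d) • (1 : A)
      = y₁ ^ 3 + y₂ ^ 3 + d • 1
        - (ρ ^ 2 * (3 * a₂)) • (x * (x * (y₂ * y₁)) + (α * p) • x + q • (x * x)) := by
  subst hy
  have h₁₂' (a : A) : y₁ * (y₂ * a) = ρ • (y₂ * (y₁ * a)) + (p * (ρ - ρ ^ 2)) • (x * (x * a)) +
      (q * (ρ - 1)) • a := by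
    rw [← mul_assoc, h₁₂]; simp only [add_mul, smul_mul_assoc, one_mul, mul_assoc]
  simp only [pow_succ (_ + _ : A), pow_succ y₁, pow_succ y₂, pow_zero, mul_add, add_mul, mul_sub,
    smul_mul_assoc, mul_smul_comm, mul_assoc, hx, cube_assoc hx, h₁, skew_mul_assoc h₁, h₂,
    skew_mul_assoc h₂, h₁₂, h₁₂', mul_one, one_mul, smul_smul, smul_add]
  have e : ρ ^ 2 = - ρ - 1 := by linear_combination hρ
  match_scalars <;> grind

/-- As `y₂ h(x) = h(ρ² x) y₂`, the element `y₂ ^ 3 * y₁ ^ 3` is the product of the three conjugates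
of `h(x) = y₂ * y₁`. -/
theorem mul_pow_three_eq {ρ α p q : F} {x y₁ y₂ W : A}
    (hρ : ρ ^ 2 + ρ + 1 = 0)
    (hx : x * (x * x) = α • (1 : A)) (h₂ : y₂ * x = ρ ^ 2 • (x * y₂))
    (h₂₁ : y₂ * y₁ = x * W - p • (x * x) - q • (1 : A))
    (hWx : W * x = x * W) (hW₁ : W * y₁ = y₁ * W) :
    y₂ ^ 3 * y₁ ^ 3 = α • W ^ 3 - (α ^ 2 * p ^ 3 + q ^ 3) • (1 : A) - (3 * α * p * q) • W := by
  have h₂₁' (a : A) : y₂ * (y₁ * a) = x * (W * a) - p • (x * (x * a)) - q • a := by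
    rw [← mul_assoc, h₂₁]; simp only [sub_mul, smul_mul_assoc, one_mul, mul_assoc]
  have hWx' (a : A) : W * (x * a) = x * (W * a) := by rw [← mul_assoc, hWx, mul_assoc]
  have hW₁' (a : A) : W * (y₁ * a) = y₁ * (W * a) := by rw [← mul_assoc, hW₁, mul_assoc]
  simp only [pow_succ y₁, pow_succ y₂, pow_succ W, pow_zero, mul_sub,
    mul_smul_comm, mul_assoc, hx, cube_assoc hx, skew_mul_assoc h₂, h₂₁, h₂₁',
    hW₁, hW₁', mul_one, one_mul, smul_smul, smul_sub]
  have e : ρ ^ 2 = - ρ - 1 := by linear_combination hρ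
  match_scalars <;> grind

namespace CubicCoeffs

variable (c : CubicCoeffs F) (ρ : F)

/-- The coefficient of `x` in `w`. -/
def p : F := ρ ^ 2 * (c.D₁ / (3 * c.α))

/-- The coefficient of `x⁻¹` in `w`. -/
def q : F := c.D₂ / (9 * c.α)

/-- The expression of `w` through `x`, `y₁`, `y₂`, in an arbitrary algebra. -/
def wOf (x y₁ y₂ : A) : A :=
  c.α⁻¹ • x ^ 2 * y₂ * y₁ + c.p ρ • x + c.q • (c.α⁻¹ • x ^ 2)

/-- The presentation of `C_Φ` by `x` and the components `y₁`, `y₂` of `y`. The component of degree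
`0` does not occur: it is a polynomial in `x`, see `y₀Of`. -/
structure IsGradedTriple (x y₁ y₂ : A) : Prop where
  cube : x * (x * x) = c.α • (1 : A)
  mul₁ : y₁ * x = ρ • (x * y₁)
  mul₂ : y₂ * x = ρ ^ 2 • (x * y₂)
  mul₁₂ : y₁ * y₂ = ρ • (y₂ * y₁) + (c.p ρ * (ρ - ρ ^ 2)) • (x * x) + (c.q * (ρ - 1)) • (1 : A)
  cubes : y₁ ^ 3 + y₂ ^ 3 = (ρ ^ 2 * c.e) • c.wOf ρ x y₁ y₂ - c.D • (1 : A)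

/-- The component of `y` of degree `0`, which the relation of bidegree `(2, 1)` expresses through
`x`. -/
def y₀Of (x : A) : A :=
  (c.r / 3) • (1 : A) + (c.β / (3 * c.α)) • x + (c.e / (3 * c.α)) • (x * x)

/-- The relations of `C_Φ` without parameters: the coefficients of `a³`, `a² b`, `a b²`, `b³` in
`Φ(ax + by, a, b)` vanish. -/
structure CliffordPair (x y : A) : Prop where
  xxx : x ^ 3 - c.α • (1 : A) = 0
  xxy : x ^ 2 * y + x * y * x + y * x ^ 2 - c.r • x ^ 2 - c.e • x - c.β • (1 : A) = 0
  xyy : x * y ^ 2 + y * x * y + y ^ 2 * x - c.r • (x * y + y * x) - c.e • y - c.t • x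
    - c.γ • (1 : A) = 0
  yyy : y ^ 3 - c.r • y ^ 2 - c.t • y - c.δ • (1 : A) = 0

/-- The component of `y` of degree `k` under conjugation by `x`, in an arbitrary algebra. -/
def component (x y : A) (k : ℕ) : A :=
  (3 : F)⁻¹ • ∑ j ∈ Finset.range 3, ρ ^ (k * j) • (x ^ j * y * (c.α⁻¹ • x ^ 2) ^ j)

variable {c ρ} {x y y₁ y₂ : A}

theorem nine_ne_zero (h3 : (3 : F) ≠ 0) : (9 : F) ≠ 0 := by
  rw [show (9 : F) = 3 ^ 2 by norm_num]; exact pow_ne_zero _ h3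

/-! The coefficients `t`, `γ`, `δ` are polynomials in `p`, `q` and the coefficients of `y₀Of`. -/

theorem t_eq (h3 : (3 : F) ≠ 0) (hα : c.α ≠ 0) :
    c.t = 3 * c.α * (c.β / (3 * c.α)) * (c.e / (3 * c.α)) - 3 * (c.r / 3) ^ 2 - 3 * c.q := by
  have := nine_ne_zero h3
  simp only [q, D₂]; field_simp; ring

theorem γ_eq (h3 : (3 : F) ≠ 0) (hα : c.α ≠ 0) (hρ : ρ ^ 3 = 1) :
    c.γ = 3 * c.α * ρ * c.p ρ - 3 * c.α * (c.r / 3) * (c.e / (3 * c.α))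
      + 3 * c.α * (c.β / (3 * c.α)) ^ 2 := by
  have : ρ * c.p ρ = c.D₁ / (3 * c.α) := by rw [p, ← mul_assoc, ← pow_succ', hρ, one_mul]
  rw [mul_assoc _ ρ, this, D₁]; field_simp; ring

theorem δ_eq (h3 : (3 : F) ≠ 0) (hα : c.α ≠ 0) (hρ : ρ ^ 3 = 1) :
    c.δ = c.α ^ 2 * (c.e / (3 * c.α)) ^ 3 + c.α * (c.β / (3 * c.α)) ^ 3 - 2 * (c.r / 3) ^ 3
      + (c.β / (3 * c.α)) * (3 * c.α * ρ * c.p ρ) - c.r / 3 * c.t - c.D := by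
  have : ρ * c.p ρ = c.D₁ / (3 * c.α) := by rw [p, ← mul_assoc, ← pow_succ', hρ, one_mul]
  have h27 : (27 : F) ≠ 0 := by
    rw [show (27 : F) = 3 ^ 3 by norm_num]; exact pow_ne_zero _ h3
  rw [mul_assoc _ ρ, this, D]; field_simp; ring

theorem wOf_eq (hα : c.α ≠ 0) : c.wOf ρ x y₁ y₂ =
    c.α⁻¹ • (x * (x * (y₂ * y₁)) + (c.α * c.p ρ) • x + c.q • (x * x)) := by
  simp only [wOf, smul_add, smul_smul, smul_mul_assoc, pow_two, mul_assoc, inv_mul_cancel_left₀ hα,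
    mul_comm]

theorem xyy_iff (hρ : ρ ^ 2 + ρ + 1 = 0) (h3 : (3 : F) ≠ 0) (hα : c.α ≠ 0)
    (hx : x * (x * x) = c.α • (1 : A)) (h₁ : y₁ * x = ρ • (x * y₁)) (h₂ : y₂ * x = ρ ^ 2 • (x * y₂))
    (hy : y = c.y₀Of x + y₁ + y₂) :
    x * y ^ 2 + y * x * y + y ^ 2 * x - c.r • (x * y + y * x) - c.e • y - c.t • x
      - c.γ • (1 : A) = 0 ↔
    y₁ * y₂ = ρ • (y₂ * y₁) + (c.p ρ * (ρ - ρ ^ 2)) • (x * x) + (c.q * (ρ - 1)) • (1 : A) := by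
  have hρ3 : ρ ^ 3 = 1 := by linear_combination (ρ - 1) * hρ
  have key := xyy_eq (p := c.p ρ) (q := c.q) hρ hx h₁ h₂ hy
  rw [← γ_eq h3 hα hρ3, ← t_eq h3 hα, mul_div_cancel₀ _ h3,
    mul_div_cancel₀ _ (mul_ne_zero h3 hα)] at key
  rw [key, smul_eq_zero_iff_right]
  · constructor
    · intro h
      -- Multiplication by `x⁻¹ = α⁻¹ x²` cancels the factor `x`.
      have h' := congrArg (fun a => c.α⁻¹ • (x * (x * a))) h
      simp only [mul_zero, smul_zero, cube_assoc hx, smul_smul, inv_mul_cancel₀ hα, one_smul] at h'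
      rw [← sub_eq_zero, ← h']; abel
    · intro h
      rw [h,
        show ∀ a b c : A, a + b + c - a - b - c = 0 by intros; abel, mul_zero]
  · intro h
    apply h3
    have e : ρ ^ 2 = 1 := by linear_combination -h
    have e' : ρ = 1 := by linear_combination hρ3 - ρ * e
    rw [e'] at hρ
    linear_combination hρ

theorem yyy_iff (hρ : ρ ^ 2 + ρ + 1 = 0) (h3 : (3 : F) ≠ 0) (hα : c.α ≠ 0)
    (hx : x * (x * x) = c.α • (1 : A)) (h₁ : y₁ * x = ρ • (x * y₁)) (h₂ : y₂ * x = ρ ^ 2 • (x * y₂))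
    (h₁₂ : y₁ * y₂ = ρ • (y₂ * y₁) + (c.p ρ * (ρ - ρ ^ 2)) • (x * x) + (c.q * (ρ - 1)) • (1 : A))
    (hy : y = c.y₀Of x + y₁ + y₂) :
    y ^ 3 - c.r • y ^ 2 - c.t • y - c.δ • (1 : A) = 0 ↔
    y₁ ^ 3 + y₂ ^ 3 = (ρ ^ 2 * c.e) • c.wOf ρ x y₁ y₂ - c.D • (1 : A) := by
  have hρ3 : ρ ^ 3 = 1 := by linear_combination (ρ - 1) * hρ
  have key := yyy_eq (p := c.p ρ) (q := c.q) (d := c.D) hρ hx h₁ h₂ h₁₂ hy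
  rw [← t_eq h3 hα, ← δ_eq h3 hα hρ3, mul_div_cancel₀ _ h3] at key
  rw [key, wOf_eq hα, smul_smul,
    show ρ ^ 2 * (3 * (c.e / (3 * c.α))) = ρ ^ 2 * c.e * c.α⁻¹ by field_simp,
    sub_eq_zero, eq_sub_iff_add_eq]

theorem IsGradedTriple.cliffordPair (h : c.IsGradedTriple ρ x y₁ y₂) (hρ : ρ ^ 2 + ρ + 1 = 0)
    (h3 : (3 : F) ≠ 0) (hα : c.α ≠ 0) : c.CliffordPair x (c.y₀Of x + y₁ + y₂) where
  xxx := by rw [sub_eq_zero, ← h.cube, pow_succ, pow_two, mul_assoc]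
  xxy := by
    have key := xxy_eq_zero hρ h.cube h.mul₁ h.mul₂ (y := c.y₀Of x + y₁ + y₂) rfl
    rwa [mul_div_cancel₀ _ h3, mul_div_cancel₀ _ (mul_ne_zero h3 hα),
      mul_div_cancel₀ _ (mul_ne_zero h3 hα)] at key
  xyy := (xyy_iff hρ h3 hα h.cube h.mul₁ h.mul₂ rfl).2 h.mul₁₂
  yyy := (yyy_iff hρ h3 hα h.cube h.mul₁ h.mul₂ h.mul₁₂ rfl).2 h.cubes

theorem component_eq (hx : x * (x * x) = c.α • (1 : A)) (hα : c.α ≠ 0) (k : ℕ) :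
    c.component ρ x y k = (3 : F)⁻¹ • (y + (ρ ^ k * c.α⁻¹) • (x * (y * (x * x)))
      + (ρ ^ (k * 2) * c.α⁻¹) • (x * (x * (y * x)))) := by
  simp only [component, Finset.sum_range_succ, Finset.sum_range_zero, pow_succ, pow_zero, mul_zero,
    mul_one, one_mul, smul_mul_assoc, mul_smul_comm, one_smul, zero_add, mul_assoc, hx, smul_smul]
  congr 3
  field_simp

theorem component_mul (hx : x * (x * x) = c.α • (1 : A)) (hα : c.α ≠ 0) (hρ : ρ ^ 3 = 1) (k : ℕ) :
    c.component ρ x y k * x = ρ ^ k • (x * c.component ρ x y k) := by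
  have e : ρ ^ (k * 3) = 1 := by rw [mul_comm, pow_mul, hρ, one_pow]
  rw [component_eq hx hα]
  simp only [smul_mul_assoc, mul_smul_comm, add_mul, mul_add, mul_assoc, hx, cube_assoc hx,
    smul_smul, mul_one, smul_add]
  match_scalars
  · field_simp
    rw [← pow_add, ← e]; ring_nf
  · field_simp
  · field_simp; ring

/-- An element is the sum of its graded components. -/
theorem component_add (hx : x * (x * x) = c.α • (1 : A)) (hα : c.α ≠ 0) (hρ : ρ ^ 2 + ρ + 1 = 0)
    (h3 : (3 : F) ≠ 0) :
    y = c.component ρ x y 0 + c.component ρ x y 1 + c.component ρ x y 2 := by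
  simp only [component_eq hx hα, smul_add, smul_smul]
  match_scalars
  · field_simp; norm_num
  · simp only [pow_zero, pow_one]
    linear_combination (-3⁻¹ * c.α⁻¹) * hρ
  · simp only [pow_zero, zero_mul, one_mul]
    linear_combination (-3⁻¹ * c.α⁻¹ * (ρ ^ 2 - ρ + 1)) * hρ

/-- The graded components of an element given as a sum of homogeneous terms are these terms. -/
theorem component_of_graded (hx : x * (x * x) = c.α • (1 : A)) (h₁ : y₁ * x = ρ • (x * y₁))
    (h₂ : y₂ * x = ρ ^ 2 • (x * y₂)) (hα : c.α ≠ 0) (hρ : ρ ^ 2 + ρ + 1 = 0) (h3 : (3 : F) ≠ 0) :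
    c.component ρ x (c.y₀Of x + y₁ + y₂) 1 = y₁ ∧ c.component ρ x (c.y₀Of x + y₁ + y₂) 2 = y₂ := by
  have e : ρ ^ 2 = - ρ - 1 := by linear_combination hρ
  constructor
  all_goals
    simp only [component_eq hx hα, y₀Of, mul_add, add_mul, smul_mul_assoc, mul_smul_comm,
      mul_assoc, hx, cube_assoc hx, h₁, skew_mul_assoc h₁, h₂, skew_mul_assoc h₂, mul_one,
      one_mul, smul_smul, smul_add]
    match_scalars <;> grind

theorem CliffordPair.isGradedTriple (h : c.CliffordPair x y) (hρ : ρ ^ 2 + ρ + 1 = 0)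
    (h3 : (3 : F) ≠ 0) (hα : c.α ≠ 0) :
    c.IsGradedTriple ρ x (c.component ρ x y 1) (c.component ρ x y 2) ∧
      y = c.y₀Of x + c.component ρ x y 1 + c.component ρ x y 2 := by
  have hρ3 : ρ ^ 3 = 1 := by linear_combination (ρ - 1) * hρ
  have hx : x * (x * x) = c.α • (1 : A) := by
    rw [← sub_eq_zero.1 h.xxx, pow_succ, pow_two, mul_assoc]
  have h₁ := component_mul (y := y) hx hα hρ3 1
  have h₂ := component_mul (y := y) hx hα hρ3 2
  rw [pow_one] at h₁
  have hy : y = c.y₀Of x + c.component ρ x y 1 + c.component ρ x y 2 := by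
    have h₀ : c.component ρ x y 0 = c.y₀Of x := by
      -- The relation of bidegree `(2, 1)` reads `3 x² y₀ = r x² + e x + β`.
      have hxxy := congrArg (fun a => (3 * c.α)⁻¹ • (x * a)) h.xxy
      simp only [mul_zero, smul_zero] at hxxy
      rw [component_eq hx hα, y₀Of, ← sub_eq_zero, ← hxxy]
      simp only [mul_add, mul_sub, pow_two, mul_smul_comm, mul_assoc, hx, cube_assoc hx, mul_one,
        smul_smul, smul_add, smul_sub]
      match_scalars <;> (field_simp; try simp)
    rw [← h₀]; exact component_add hx hα hρ h3
  have h₁₂ := (xyy_iff hρ h3 hα hx h₁ h₂ hy).1 h.xyy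
  exact ⟨⟨hx, h₁, h₂, h₁₂, (yyy_iff hρ h3 hα hx h₁ h₂ h₁₂ hy).1 h.yyy⟩, hy⟩

end CubicCoeffs
end

/-! ### Central elements and the curve equation -/

section
variable {F A : Type*} [Field F] [Ring A] [Algebra F A]

namespace CubicCoeffs
variable {c : CubicCoeffs F} {ρ : F} {x y y₁ y₂ : A}

namespace IsGradedTriple
variable (h : c.IsGradedTriple ρ x y₁ y₂) (hρ : ρ ^ 2 + ρ + 1 = 0) (hα : c.α ≠ 0)
include h

theorem mul₁₂_assoc (a : A) :
    y₁ * (y₂ * a) = ρ • (y₂ * (y₁ * a)) + (c.p ρ * (ρ - ρ ^ 2)) • (x * (x * a))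
      + (c.q * (ρ - 1)) • a := by
  rw [← mul_assoc, h.mul₁₂]; simp only [add_mul, smul_mul_assoc, one_mul, mul_assoc]

include hα in
theorem mul₂₁ : y₂ * y₁ = x * c.wOf ρ x y₁ y₂ - c.p ρ • (x * x) - c.q • (1 : A) := by
  rw [wOf_eq hα]
  simp only [mul_smul_comm, mul_add, cube_assoc h.cube, h.cube, smul_smul, smul_add]
  match_scalars <;> field_simp <;> simp

include hρ in
theorem commute_w_x (hα : c.α ≠ 0) : c.wOf ρ x y₁ y₂ * x = x * c.wOf ρ x y₁ y₂ := by
  have hρ3 : ρ ^ 3 = 1 := by linear_combination (ρ - 1) * hρ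
  rw [wOf_eq hα]
  simp only [mul_smul_comm, smul_mul_assoc, mul_add, add_mul, mul_assoc, h.mul₁,
    skew_mul_assoc h.mul₂, smul_smul, ← pow_succ', hρ3, one_smul]

include hρ in
theorem commute_w_y₁ (hα : c.α ≠ 0) : c.wOf ρ x y₁ y₂ * y₁ = y₁ * c.wOf ρ x y₁ y₂ := by
  rw [wOf_eq hα]
  simp only [mul_smul_comm, smul_mul_assoc, mul_add, add_mul, mul_assoc, h.mul₁,
    skew_mul_assoc h.mul₁, smul_smul, smul_add, h.mul₁₂_assoc,
    cube_assoc h.cube]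
  have e : ρ ^ 2 = - ρ - 1 := by linear_combination hρ
  match_scalars <;> grind

include hρ in
theorem commute_w_y₂ (hα : c.α ≠ 0) : c.wOf ρ x y₁ y₂ * y₂ = y₂ * c.wOf ρ x y₁ y₂ := by
  rw [wOf_eq hα]
  simp only [mul_smul_comm, smul_mul_assoc, mul_add, add_mul, mul_assoc, h.mul₂,
    skew_mul_assoc h.mul₂, smul_smul, smul_add, h.mul₁₂,
    cube_assoc h.cube, mul_one]
  have e : ρ ^ 2 = - ρ - 1 := by linear_combination hρ
  match_scalars <;> grind

include hρ in
theorem commute_y₁_cube_x : y₁ ^ 3 * x = x * y₁ ^ 3 := by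
  have hρ3 : ρ ^ 3 = 1 := by linear_combination (ρ - 1) * hρ
  simp only [pow_succ y₁, pow_zero, one_mul, mul_assoc, h.mul₁, skew_mul_assoc h.mul₁,
    mul_smul_comm, smul_smul]
  rw [show ρ * (ρ * ρ) = 1 by rw [← hρ3]; ring, one_smul]

include hρ in
theorem commute_y₁_cube_y₂ : y₁ ^ 3 * y₂ = y₂ * y₁ ^ 3 := by
  simp only [pow_succ y₁, pow_zero, one_mul, mul_assoc, h.mul₁, skew_mul_assoc h.mul₁,
    mul_smul_comm, smul_smul, smul_add, h.mul₁₂, h.mul₁₂_assoc, mul_add, mul_one]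
  have e : ρ ^ 2 = - ρ - 1 := by linear_combination hρ
  match_scalars <;> grind

theorem y₂_cube : y₂ ^ 3 = (ρ ^ 2 * c.e) • c.wOf ρ x y₁ y₂ - c.D • (1 : A) - y₁ ^ 3 := by
  rw [← h.cubes]; abel

end IsGradedTriple

/-- The equation of `E` in the form `α N = T S`, where `T = ρ² e R - D - S` and `α N` is the product
of the conjugates in `mul_pow_three_eq`. -/
theorem curveEq_eq (h3 : (3 : F) ≠ 0) (hα : c.α ≠ 0) (hρ : ρ ^ 2 + ρ + 1 = 0) {K : Type*}
    [Field K] [Algebra F K] (R S : K) :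
    c.curveEq ρ R S = algebraMap F K c.α * R ^ 3 - algebraMap F K (c.α ^ 2 * c.p ρ ^ 3 + c.q ^ 3)
      - algebraMap F K (3 * c.α * c.p ρ * c.q) * R
      - (algebraMap F K (ρ ^ 2 * c.e) * R - algebraMap F K c.D - S) * S := by
  have hρ3 : ρ ^ 3 = 1 := by linear_combination (ρ - 1) * hρ
  have h9 := nine_ne_zero h3
  have h27 : (27 : F) ≠ 0 := by
    rw [show (27 : F) = 3 ^ 3 by norm_num]; exact pow_ne_zero _ h3
  have h729 : (729 : F) ≠ 0 := by
    rw [show (729 : F) = 3 ^ 6 by norm_num]; exact pow_ne_zero _ h3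
  have e1 : c.α ^ 2 * c.p ρ ^ 3 + c.q ^ 3 = c.D₁ ^ 3 / (27 * c.α) + c.D₂ ^ 3 / (729 * c.α ^ 3) := by
    rw [p, q, mul_pow, ← pow_mul, mul_comm 2 3, pow_mul ρ, hρ3]
    field_simp; ring
  have e2 : 3 * c.α * c.p ρ * c.q = ρ ^ 2 * (c.D₁ * c.D₂ / (9 * c.α)) := by
    rw [p, q]; field_simp
  rw [e1, e2, curveEq, map_add]
  ring

section Scalars

variable {K : Type*} [Field K] [Algebra F K] [Algebra K A] [IsScalarTower F K A] {R S : K}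

/-- At a point of `E` the rules for the cubes follow from those for the products: the curve equation
says `y₂ ^ 3 * y₁ ^ 3 = T * S`, so each cube determines the other. -/
theorem isGradedTriple_of_scalars (h3 : (3 : F) ≠ 0) (hα : c.α ≠ 0) (hρ : ρ ^ 2 + ρ + 1 = 0)
    (hc : c.curveEq ρ R S = 0)
    (hx : x * (x * x) = c.α • (1 : A)) (h₁ : y₁ * x = ρ • (x * y₁)) (h₂ : y₂ * x = ρ ^ 2 • (x * y₂))
    (h₂₁ : y₂ * y₁ = R • x - c.p ρ • (x * x) - c.q • (1 : A))
    (h₁₂ : y₁ * y₂ = ρ • R • x - (ρ ^ 2 * c.p ρ) • (x * x) - c.q • (1 : A))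
    (hS : (S ≠ 0 ∧ y₁ ^ 3 = S • (1 : A)) ∨
      (algebraMap F K (ρ ^ 2 * c.e) * R - algebraMap F K c.D - S ≠ 0 ∧
        y₂ ^ 3 = (algebraMap F K (ρ ^ 2 * c.e) * R - algebraMap F K c.D - S) • (1 : A))) :
    c.IsGradedTriple ρ x y₁ y₂ ∧ c.wOf ρ x y₁ y₂ = R • (1 : A) ∧ y₁ ^ 3 = S • (1 : A) := by
  have hw : c.wOf ρ x y₁ y₂ = R • (1 : A) := by
    rw [wOf_eq hα, h₂₁]
    simp only [mul_sub, mul_smul_comm, hx, smul_add, smul_sub, smul_smul, mul_one,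
      smul_comm R c.α, inv_mul_cancel₀ hα, inv_mul_cancel_left₀ hα, one_smul]
    rw [mul_comm (c.p ρ), inv_mul_cancel_left₀ hα]
    abel
  set T := algebraMap F K (ρ ^ 2 * c.e) * R - algebraMap F K c.D - S with hT
  have hρK : (algebraMap F K ρ) ^ 2 + algebraMap F K ρ + 1 = 0 := by
    rw [← map_pow, ← map_add, ← map_one (algebraMap F K), ← map_add, hρ, map_zero]
  have hprod : y₂ ^ 3 * y₁ ^ 3 = (T * S) • (1 : A) := by
    rw [mul_pow_three_eq (α := algebraMap F K c.α) (p := algebraMap F K (c.p ρ))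
      (q := algebraMap F K c.q) (x := x) (W := R • 1) hρK (by rw [hx, algebraMap_smul])
      (by rw [h₂, ← map_pow, algebraMap_smul])
      (by rw [h₂₁, algebraMap_smul, algebraMap_smul, mul_smul_comm, mul_one])
      (by rw [smul_mul_assoc, mul_smul_comm, one_mul, mul_one])
      (by rw [smul_mul_assoc, mul_smul_comm, one_mul, mul_one])]
    rw [curveEq_eq h3 hα hρ, sub_eq_zero, ← hT] at hc
    rw [← hc, smul_pow, one_pow, smul_smul, smul_smul, ← sub_smul, ← sub_smul]
    simp only [map_add, map_mul, map_pow, map_ofNat]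
  have hcubes : y₁ ^ 3 = S • (1 : A) ∧ y₂ ^ 3 = T • (1 : A) := by
    rcases hS with ⟨h0, h⟩ | ⟨h0, h⟩
    · refine ⟨h, ?_⟩
      rw [h, mul_smul_comm, mul_one, mul_comm, mul_smul] at hprod
      exact smul_right_injective A h0 hprod
    · refine ⟨?_, h⟩
      rw [h, smul_mul_assoc, one_mul, mul_smul] at hprod
      exact smul_right_injective A h0 hprod
  refine ⟨⟨hx, h₁, h₂, ?_, ?_⟩, hw, hcubes.1⟩
  · rw [h₁₂, h₂₁]
    simp only [smul_sub]
    module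
  · rw [hcubes.1, hcubes.2, hw, ← add_smul, hT, ← algebraMap_smul K (ρ ^ 2 * c.e), smul_smul,
      ← algebraMap_smul K c.D, ← sub_smul]
    congr 1; ring

/-- For `S ≠ 0` the triple is recovered from `x` and `y₁`, with `y₂ = h(x) y₁⁻¹`. -/
theorem isGradedTriple_of_S_ne_zero (h3 : (3 : F) ≠ 0) (hα : c.α ≠ 0) (hρ : ρ ^ 2 + ρ + 1 = 0)
    (hc : c.curveEq ρ R S = 0) (hS : S ≠ 0)
    (hx : x * (x * x) = c.α • (1 : A)) (h₁ : y₁ * x = ρ • (x * y₁))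
    (hy₁ : y₁ * (y₁ * y₁) = S • (1 : A))
    (hy₂ : y₂ = S⁻¹ • ((R • x - c.p ρ • (x * x) - c.q • (1 : A)) * (y₁ * y₁))) :
    c.IsGradedTriple ρ x y₁ y₂ ∧ c.wOf ρ x y₁ y₂ = R • (1 : A) ∧ y₁ ^ 3 = S • (1 : A) := by
  refine isGradedTriple_of_scalars h3 hα hρ hc hx h₁ ?_ ?_ ?_ (.inl ⟨hS, ?_⟩)
  · rw [hy₂]
    simp only [smul_mul_assoc, mul_smul_comm, mul_sub, sub_mul, mul_assoc, h₁, skew_mul_assoc h₁,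
      one_mul, smul_sub]
    module
  · rw [hy₂, smul_mul_assoc, mul_assoc, mul_assoc, hy₁, mul_smul_comm, mul_one, smul_smul,
      inv_mul_cancel₀ hS, one_smul]
  · rw [hy₂, mul_smul_comm]
    simp only [smul_mul_assoc, mul_smul_comm, mul_sub, sub_mul, mul_assoc, skew_mul_assoc h₁,
      one_mul, hy₁, smul_sub, mul_one]
    match_scalars <;> field_simp
  · rw [← hy₁, pow_succ, pow_two, mul_assoc]

/-- For `T ≠ 0` the triple is recovered from `x` and `y₂`, with `y₁ = y₂⁻¹ h(x)`. -/
theorem isGradedTriple_of_T_ne_zero (h3 : (3 : F) ≠ 0) (hα : c.α ≠ 0) (hρ : ρ ^ 2 + ρ + 1 = 0)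
    (hc : c.curveEq ρ R S = 0) {T : K}
    (hT : T = algebraMap F K (ρ ^ 2 * c.e) * R - algebraMap F K c.D - S) (hT0 : T ≠ 0)
    (hx : x * (x * x) = c.α • (1 : A)) (h₂ : x * y₂ = ρ • (y₂ * x))
    (hy₂ : y₂ * (y₂ * y₂) = T • (1 : A))
    (hy₁ : y₁ = T⁻¹ • (y₂ * (y₂ * (R • x - c.p ρ • (x * x) - c.q • (1 : A))))) :
    c.IsGradedTriple ρ x y₁ y₂ ∧ c.wOf ρ x y₁ y₂ = R • (1 : A) ∧ y₁ ^ 3 = S • (1 : A) := by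
  have e : ρ ^ 2 * ρ = 1 := by linear_combination (ρ - 1) * hρ
  have eK : algebraMap F K ρ ^ 3 = 1 := by rw [← map_pow, pow_succ, e, map_one]
  have h₂' : y₂ * x = ρ ^ 2 • (x * y₂) := by
    rw [h₂, smul_smul, e, one_smul]
  refine isGradedTriple_of_scalars h3 hα hρ hc hx ?_ h₂' ?_ ?_ (.inr ⟨hT ▸ hT0, ?_⟩)
  · rw [hy₁]
    simp only [smul_mul_assoc, mul_smul_comm, mul_sub, sub_mul, mul_assoc, h₂, skew_mul_assoc h₂,
      smul_sub, mul_one]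
    match_scalars <;> (field_simp; rw [eK, mul_one])
  · rw [hy₁, mul_smul_comm, cube_assoc hy₂, smul_smul, inv_mul_cancel₀ hT0, one_smul]
  · rw [hy₁, smul_mul_assoc]
    simp only [smul_mul_assoc, mul_smul_comm, mul_sub, sub_mul, mul_assoc, h₂, skew_mul_assoc h₂,
      cube_assoc hy₂, hy₂, smul_sub, mul_one]
    match_scalars <;> field_simp
  · rw [← hT, ← hy₂, pow_succ, pow_two, mul_assoc]

end Scalars

end CubicCoeffs
end

/-! ### A finiteness criterion -/

section
variable {R A : Type*} [CommRing R] [Ring A] [Algebra R A]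

/-- A product of two submodules that contains `1` and is stable under left multiplication by the
generators of the algebra is everything. -/
theorem submodule_mul_eq_top {X Y : Submodule R A} {s : Set A} (hs : Algebra.adjoin R s = ⊤)
    (hX : 1 ∈ X) (hY : 1 ∈ Y) (h : ∀ g ∈ s, ∀ a ∈ X, ∀ b ∈ Y, g * (a * b) ∈ X * Y) :
    X * Y = ⊤ := by
  have key : ∀ z ∈ Algebra.adjoin R s, ∀ m ∈ X * Y, z * m ∈ X * Y := by
    intro z hz
    induction hz using Algebra.adjoin_induction with
    | mem g hg =>
      intro m hm
      induction hm using Submodule.mul_induction_on' with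
      | mem_mul_mem a ha b hb => exact h g hg a ha b hb
      | add m _ n _ hm hn => rw [mul_add]; exact add_mem hm hn
    | algebraMap r => intro m hm; rw [← Algebra.smul_def]; exact Submodule.smul_mem _ _ hm
    | add a b _ _ ha hb => intro m hm; rw [add_mul]; exact add_mem (ha m hm) (hb m hm)
    | mul a b _ _ ha hb => intro m hm; rw [mul_assoc]; exact ha _ (hb m hm)
  refine eq_top_iff.2 fun z _ => ?_
  have := key z (hs ▸ Algebra.mem_top) (1 * 1) (Submodule.mul_mem_mul hX hY)
  rwa [mul_one, mul_one] at this

/-- The span of `1`, `u`, `u ^ 2`. -/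
def spanCube (R : Type*) [CommRing R] [Algebra R A] (u : A) : Submodule R A :=
  Submodule.span R {1, u, u * u}

theorem mem_spanCube {u a : A} : a ∈ spanCube R u ↔ ∃ i j k : R, i • 1 + j • u + k • (u * u) = a :=
  Submodule.mem_span_triple

theorem one_mem_spanCube (u : A) : 1 ∈ spanCube R u := Submodule.subset_span (by simp)

theorem mul_mem_spanCube {α : R} {u a b : A} (hu : u * (u * u) = α • (1 : A))
    (ha : a ∈ spanCube R u) (hb : b ∈ spanCube R u) : a * b ∈ spanCube R u := by
  obtain ⟨i, j, k, rfl⟩ := mem_spanCube.1 ha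
  obtain ⟨i', j', k', rfl⟩ := mem_spanCube.1 hb
  refine mem_spanCube.2 ⟨i * i' + α * j * k' + α * k * j', i * j' + j * i' + α * k * k',
    i * k' + j * j' + k * i', ?_⟩
  simp only [mul_add, add_mul, smul_mul_assoc, mul_smul_comm, mul_assoc, one_mul, mul_one, hu]
  module

theorem exists_mul_eq_of_mem_spanCube {ζ : R} {u v a : A} (h : v * u = ζ • (u * v))
    (ha : a ∈ spanCube R u) : ∃ b ∈ spanCube R u, v * a = b * v := by
  obtain ⟨i, j, k, rfl⟩ := mem_spanCube.1 ha
  refine ⟨_, mem_spanCube.2 ⟨i, ζ * j, ζ ^ 2 * k, rfl⟩, ?_⟩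
  simp only [mul_add, add_mul, smul_mul_assoc, mul_smul_comm, mul_assoc, one_mul, mul_one, h]
  rw [← mul_assoc v u u, h, smul_mul_assoc, mul_assoc, h, mul_smul_comm]
  module

theorem spanCube_fg (u : A) : (spanCube R u).FG := Submodule.fg_span (by simp)

/-- The algebra is spanned by the products of `1, x, x²` with `1, y₁, y₁², y₂, y₂²`. -/
theorem finite_of_graded {ζ₁ ζ₂ α s t : R} {x y₁ y₂ : A} (hx : x * (x * x) = α • (1 : A))
    (h₁ : y₁ * x = ζ₁ • (x * y₁)) (h₂ : y₂ * x = ζ₂ • (x * y₂))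
    (h₁₂ : y₁ * y₂ ∈ spanCube R x) (h₂₁ : y₂ * y₁ ∈ spanCube R x)
    (hs : y₁ * (y₁ * y₁) = s • (1 : A)) (ht : y₂ * (y₂ * y₂) = t • (1 : A))
    (hgen : Algebra.adjoin R {x, y₁, y₂} = ⊤) : Module.Finite R A := by
  set X := spanCube R x with hX
  set Y : Submodule R A := spanCube R y₁ ⊔ spanCube R y₂ with hY
  have h1Y : 1 ∈ Y := Submodule.mem_sup_left (one_mem_spanCube _)
  have hXY {a b : A} (ha : a ∈ X) (hb : b ∈ X * Y) : a * b ∈ X * Y := by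
    induction hb using Submodule.mul_induction_on' with
    | mem_mul_mem b hb c hc =>
      rw [← mul_assoc]; exact Submodule.mul_mem_mul (mul_mem_spanCube hx ha hb) hc
    | add m _ n _ hm hn => rw [mul_add]; exact add_mem hm hn
  have hle : Y ≤ X * Y := fun b hb => by
    simpa using Submodule.mul_mem_mul (one_mem_spanCube x) hb
  have hleX : X ≤ X * Y := fun b hb => by
    simpa using Submodule.mul_mem_mul hb h1Y
  have aux {v v' : A} {σ : R} (hv : v * (v * v) = σ • (1 : A)) (hvv : v * v' ∈ X)
      (hvY : spanCube R v ≤ Y) (hvY' : spanCube R v' ≤ Y) {b : A}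
      (hb : b ∈ spanCube R v ⊔ spanCube R v') : v * b ∈ X * Y := by
    obtain ⟨m, hm, n, hn, rfl⟩ := Submodule.mem_sup.1 hb
    have hvm : v ∈ spanCube R v := Submodule.subset_span (by simp)
    rw [mul_add]
    refine add_mem (hle (hvY (mul_mem_spanCube hv hvm hm))) ?_
    obtain ⟨i, j, k, rfl⟩ := mem_spanCube.1 hn
    rw [mul_add, mul_add, mul_smul_comm, mul_smul_comm, mul_smul_comm, ← mul_assoc, mul_one]
    refine add_mem (add_mem ?_ ?_) ?_ <;> apply Submodule.smul_mem
    · exact hle (hvY hvm)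
    · exact hleX hvv
    · exact Submodule.mul_mem_mul hvv (hvY' (Submodule.subset_span (by simp)))
  have htop : X * Y = ⊤ := by
    refine submodule_mul_eq_top hgen (one_mem_spanCube x) h1Y ?_
    rintro g (rfl | rfl | rfl) a ha b hb
    · rw [← mul_assoc]
      exact Submodule.mul_mem_mul (mul_mem_spanCube hx (Submodule.subset_span (by simp)) ha) hb
    · obtain ⟨a', ha', e⟩ := exists_mul_eq_of_mem_spanCube h₁ ha
      rw [← mul_assoc, e, mul_assoc]
      exact hXY ha' (aux hs h₁₂ le_sup_left le_sup_right hb)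
    · obtain ⟨a', ha', e⟩ := exists_mul_eq_of_mem_spanCube h₂ ha
      rw [← mul_assoc, e, mul_assoc]
      exact hXY ha' (aux ht h₂₁ le_sup_right le_sup_left (by rwa [sup_comm]))
  exact ⟨htop ▸ (spanCube_fg x).mul ((spanCube_fg y₁).sup (spanCube_fg y₂))⟩

end

/-! ### Algebras generated by a symbol pair -/

section
variable {L A : Type*} [Field L] [Ring A] [Algebra L A] {ζ a b : L} {u v : A}

/-- A two-sided ideal contains the components of its elements under conjugation by a unit `u` whose
cube is a scalar. -/
theorem mem_of_add_mem {z₀ z₁ z₂ : A} (hζ : ζ ^ 2 + ζ + 1 = 0) (h3 : (3 : L) ≠ 0) (ha : a ≠ 0)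
    (hu : u * (u * u) = a • (1 : A)) (h₀ : z₀ * u = u * z₀) (h₁ : z₁ * u = ζ • (u * z₁))
    (h₂ : z₂ * u = ζ ^ 2 • (u * z₂)) (I : TwoSidedIdeal A) (hz : z₀ + z₁ + z₂ ∈ I) :
    z₀ ∈ I ∧ z₁ ∈ I ∧ z₂ ∈ I := by
  have e : ζ ^ 2 = - ζ - 1 := by linear_combination hζ
  have hI (r : L) {m : A} (hm : m ∈ I) : r • m ∈ I := by
    rw [Algebra.smul_def]; exact I.mul_mem_left _ _ hm
  set z := z₀ + z₁ + z₂ with hzdef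
  -- The projection to the component of degree `k`, as an average of conjugates by powers of `u`.
  have key (k : ℕ) : (3 : L)⁻¹ • (z + (ζ ^ k * a⁻¹) • (u * z * (u * u))
      + (ζ ^ (2 * k) * a⁻¹) • (u * u * z * u)) ∈ I :=
    hI _ (add_mem (add_mem hz (hI _ (I.mul_mem_right _ _ (I.mul_mem_left _ _ hz))))
      (hI _ (I.mul_mem_right _ _ (I.mul_mem_left _ _ hz))))
  have hc (a : A) : z₀ * (u * a) = u * (z₀ * a) := by rw [← mul_assoc, h₀, mul_assoc]
  simp only [hzdef, mul_add, add_mul, mul_assoc, h₀, h₁, h₂, hc, skew_mul_assoc h₁,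
    skew_mul_assoc h₂, mul_smul_comm, cube_assoc hu] at key
  refine ⟨?_, ?_, ?_⟩
  · convert key 0 using 1; match_scalars <;> grind
  · convert key 1 using 1; match_scalars <;> grind
  · convert key 2 using 1; match_scalars <;> grind

theorem mem_mul_cancel (hv : v * (v * v) = b • (1 : A)) (hb : b ≠ 0) (I : TwoSidedIdeal A) {m : A}
    (h : m * v ∈ I) : m ∈ I := by
  have := I.mul_mem_right _ (algebraMap L A b⁻¹ * (v * v)) h
  rwa [← Algebra.smul_def, mul_smul_comm, mul_assoc, hv, mul_smul_comm, smul_smul,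
    inv_mul_cancel₀ hb, one_smul, mul_one] at this

/-- A nonzero algebra generated by `u`, `v` with `u ^ 3 = a ≠ 0`, `v ^ 3 = b ≠ 0` and
`v * u = ζ • (u * v)` is central simple: a two-sided ideal contains with an element `∑ cᵢⱼ uⁱ vʲ`
each term `cᵢⱼ uⁱ vʲ`, a unit unless `cᵢⱼ = 0`. -/
theorem isCentralSimple_of_symbol [Nontrivial A] (hζ : ζ ^ 2 + ζ + 1 = 0) (h3 : (3 : L) ≠ 0)
    (ha : a ≠ 0) (hb : b ≠ 0) (hu : u * (u * u) = a • (1 : A)) (hv : v * (v * v) = b • (1 : A))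
    (hvu : v * u = ζ • (u * v)) (hgen : Algebra.adjoin L {u, v} = ⊤) : IsCentralSimple L A := by
  have huv : spanCube L u * spanCube L v = ⊤ := by
    refine submodule_mul_eq_top hgen (one_mem_spanCube u) (one_mem_spanCube v) ?_
    rintro g (rfl | rfl) m hm n hn
    · rw [← mul_assoc]
      exact Submodule.mul_mem_mul (mul_mem_spanCube hu (Submodule.subset_span (by simp)) hm) hn
    · obtain ⟨m', hm', e⟩ := exists_mul_eq_of_mem_spanCube hvu hm
      rw [← mul_assoc, e, mul_assoc]
      exact Submodule.mul_mem_mul hm' (mul_mem_spanCube hv (Submodule.subset_span (by simp)) hn)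
  have hfin : FiniteDimensional L A := ⟨huv ▸ (spanCube_fg u).mul (spanCube_fg v)⟩
  have hdec (z : A) : ∃ m₀ ∈ spanCube L u, ∃ m₁ ∈ spanCube L u, ∃ m₂ ∈ spanCube L u,
      z = m₀ + m₁ * v + m₂ * v * v := by
    have hz : z ∈ spanCube L u * spanCube L v := huv ▸ Submodule.mem_top
    induction hz using Submodule.mul_induction_on' with
    | mem_mul_mem m hm n hn =>
      obtain ⟨i, j, k, rfl⟩ := mem_spanCube.1 hn
      refine ⟨_, Submodule.smul_mem _ i hm, _, Submodule.smul_mem _ j hm, _,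
        Submodule.smul_mem _ k hm, ?_⟩
      simp only [mul_add, mul_smul_comm, smul_mul_assoc, mul_one, mul_assoc]
    | add m _ n _ hm hn =>
      obtain ⟨m₀, h₀, m₁, h₁, m₂, h₂, rfl⟩ := hm
      obtain ⟨n₀, h₀', n₁, h₁', n₂, h₂', rfl⟩ := hn
      refine ⟨_, add_mem h₀ h₀', _, add_mem h₁ h₁', _, add_mem h₂ h₂', ?_⟩
      simp only [add_mul]; abel
  have hcomm {m : A} (hm : m ∈ spanCube L u) : m * u = u * m := by
    obtain ⟨i, j, k, rfl⟩ := mem_spanCube.1 hm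
    simp only [mul_add, add_mul, smul_mul_assoc, mul_smul_comm, mul_assoc, one_mul, mul_one]
  have hg₁ {m : A} (hm : m ∈ spanCube L u) : m * v * u = ζ • (u * (m * v)) := by
    rw [mul_assoc, hvu, mul_smul_comm, ← mul_assoc, hcomm hm, mul_assoc]
  have hg₂ {m : A} (hm : m ∈ spanCube L u) : m * v * v * u = ζ ^ 2 • (u * (m * v * v)) := by
    rw [mul_assoc, hvu, mul_smul_comm, ← mul_assoc, hg₁ hm, smul_mul_assoc, smul_smul, pow_two,
      mul_assoc u]
  have e3 : ζ ^ 2 * ζ = 1 := by linear_combination (ζ - 1) * hζ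
  have huv' : u * v = ζ ^ 2 • (v * u) := by rw [hvu, smul_smul, e3, one_smul]
  have huu : u * u * v = ζ • (v * (u * u)) := by
    rw [mul_assoc, huv', mul_smul_comm, ← mul_assoc, huv', smul_mul_assoc, smul_smul, mul_assoc]
    congr 1
    linear_combination ζ * e3
  have hcoef (I : TwoSidedIdeal A) (i j k : L) (hI : i • 1 + j • u + k • (u * u) ∈ I) :
      i • (1 : A) ∈ I ∧ k • (u * u) ∈ I ∧ j • u ∈ I := by
    rw [add_assoc, add_comm (j • u), ← add_assoc] at hI
    refine mem_of_add_mem hζ h3 hb hv ?_ ?_ ?_ I hI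
    · rw [smul_mul_assoc, one_mul, mul_smul_comm, mul_one]
    · rw [smul_mul_assoc, huu, mul_smul_comm, smul_comm]
    · rw [smul_mul_assoc, huv', mul_smul_comm, smul_comm]
  have hscal (I : TwoSidedIdeal A) (hI : (1 : A) ∉ I) {i : L} (hi : i • (1 : A) ∈ I) : i = 0 := by
    by_contra h0
    apply hI
    have := I.mul_mem_left (algebraMap L A i⁻¹) _ hi
    rwa [← Algebra.smul_def, smul_smul, inv_mul_cancel₀ h0, one_smul] at this
  have hspan (I : TwoSidedIdeal A) (hI : (1 : A) ∉ I) {m : A} (hm : m ∈ spanCube L u)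
      (hmI : m ∈ I) : m = 0 := by
    obtain ⟨i, j, k, rfl⟩ := mem_spanCube.1 hm
    obtain ⟨hi, hk, hj⟩ := hcoef I i j k hmI
    rw [hscal I hI hi,
      hscal I hI (i := j) (mem_mul_cancel hu ha I (by rwa [smul_mul_assoc, one_mul])),
      hscal I hI (i := k) (mem_mul_cancel hu ha I (mem_mul_cancel hu ha I
        (by rwa [smul_mul_assoc, one_mul, smul_mul_assoc])))]
    simp
  refine ⟨⟨fun z hz => ?_⟩, ⟨⟨fun I => ?_⟩⟩, hfin⟩
  · rw [Subalgebra.mem_center_iff] at hz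
    have h1 : (1 : A) ∉ (⊥ : TwoSidedIdeal A) := by
      rw [TwoSidedIdeal.mem_bot]; exact one_ne_zero
    obtain ⟨m₀, hm₀, m₁, hm₁, m₂, hm₂, hzm⟩ := hdec z
    -- A central `z` has degree `0` for `u` and for `v`, so all its other components vanish.
    have h0 := (mem_of_add_mem (z₀ := m₀ - z) hζ h3 ha hu
      (by rw [sub_mul, mul_sub, hcomm hm₀, hz u]) (hg₁ hm₁) (hg₂ hm₂) ⊥
      (by rw [TwoSidedIdeal.mem_bot]; nth_rw 1 [hzm]; abel)).1
    rw [TwoSidedIdeal.mem_bot, sub_eq_zero] at h0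
    obtain ⟨i, j, k, hijk⟩ := mem_spanCube.1 hm₀
    have h0' := (mem_of_add_mem (z₀ := i • (1 : A) - z) (z₁ := k • (u * u))
        (z₂ := j • u) hζ h3 hb hv
      (by rw [sub_mul, mul_sub, smul_mul_assoc, one_mul, mul_smul_comm, mul_one, hz v])
      (by rw [smul_mul_assoc, huu, mul_smul_comm, smul_comm])
      (by rw [smul_mul_assoc, huv', mul_smul_comm, smul_comm]) ⊥
      (by rw [TwoSidedIdeal.mem_bot, ← h0, ← hijk]; abel)).1
    rw [TwoSidedIdeal.mem_bot, sub_eq_zero] at h0'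
    rw [← h0', ← Algebra.algebraMap_eq_smul_one]
    exact Subalgebra.algebraMap_mem _ _
  · by_cases hI : (1 : A) ∈ I
    · right
      rw [eq_top_iff]
      intro z _
      simpa using I.mul_mem_left z 1 hI
    · left
      rw [eq_bot_iff]
      intro z hz
      obtain ⟨m₀, hm₀, m₁, hm₁, m₂, hm₂, rfl⟩ := hdec z
      obtain ⟨k₀, k₁, k₂⟩ := mem_of_add_mem hζ h3 ha hu (hcomm hm₀) (hg₁ hm₁) (hg₂ hm₂) I hz
      rw [hspan I hI hm₀ k₀, hspan I hI hm₁ (mem_mul_cancel hv hb I k₁),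
        hspan I hI hm₂ (mem_mul_cancel hv hb I (mem_mul_cancel hv hb I k₂))]
      simp
end

/-! ### Symbol algebras -/

section
variable {L : Type*} [Field L]

theorem three_ne_zero_of_isPrimitiveRoot {ζ : L} (h : IsPrimitiveRoot ζ 3) : (3 : L) ≠ 0 := by
  have := h.neZero'
  exact_mod_cast this.out

theorem sq_add_self_add_one {ζ : L} (h : IsPrimitiveRoot ζ 3) : ζ ^ 2 + ζ + 1 = 0 := by
  have := h.geom_sum_eq_zero (by norm_num)
  simpa [Finset.sum_range_succ, add_comm, add_left_comm, add_assoc] using this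

namespace SymbolAlgebra
variable (d : ℕ) (ζ a b : L)

/-- The first generator of the symbol algebra. -/
def u : SymbolAlgebra d ζ a b := RingQuot.mkAlgHom L (SymbolRel d ζ a b) (FreeAlgebra.ι L 0)

/-- The second generator of the symbol algebra. -/
def v : SymbolAlgebra d ζ a b := RingQuot.mkAlgHom L (SymbolRel d ζ a b) (FreeAlgebra.ι L 1)

theorem u_pow : u d ζ a b ^ d = a • 1 := by
  rw [u, ← map_pow, RingQuot.mkAlgHom_rel L (SymbolRel.pow_fst (b := b)), AlgHom.commutes,
    Algebra.algebraMap_eq_smul_one]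

theorem v_pow : v d ζ a b ^ d = b • 1 := by
  rw [v, ← map_pow, RingQuot.mkAlgHom_rel L (SymbolRel.pow_snd (b := b)), AlgHom.commutes,
    Algebra.algebraMap_eq_smul_one]

theorem v_mul_u : v d ζ a b * u d ζ a b = ζ • (u d ζ a b * v d ζ a b) := by
  rw [u, v, ← map_mul, RingQuot.mkAlgHom_rel L SymbolRel.comm, map_smul, map_mul]

theorem adjoin_eq_top : Algebra.adjoin L {u d ζ a b, v d ζ a b} = ⊤ := by
  have h : Set.range (FreeAlgebra.ι L : Fin 2 → FreeAlgebra L (Fin 2)) =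
      {FreeAlgebra.ι L 0, FreeAlgebra.ι L 1} := by
    ext z; simp [Fin.exists_fin_two, eq_comm]
  have h' := congrArg (Subalgebra.map (RingQuot.mkAlgHom L (SymbolRel d ζ a b)))
    (FreeAlgebra.adjoin_range_ι (R := L) (X := Fin 2))
  rw [AlgHom.map_adjoin, h, Algebra.map_top, Set.image_pair,
    (AlgHom.range_eq_top _).2 (RingQuot.mkAlgHom_surjective _ _)] at h'
  exact h'

variable {d ζ a b}

/-- The universal property of the symbol algebra. -/
def lift {A : Type*} [Ring A] [Algebra L A] {U V : A} (hU : U ^ d = a • 1) (hV : V ^ d = b • 1)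
    (h : V * U = ζ • (U * V)) : SymbolAlgebra d ζ a b →ₐ[L] A :=
  RingQuot.liftAlgHom L ⟨FreeAlgebra.lift L ![U, V], by
    rintro _ _ (_ | _ | _)
    · simp [hU, Algebra.algebraMap_eq_smul_one]
    · simp [hV, Algebra.algebraMap_eq_smul_one]
    · simp [h]⟩

section
variable {A : Type*} [Ring A] [Algebra L A] {U V : A} (hU : U ^ d = a • 1) (hV : V ^ d = b • 1)
    (h : V * U = ζ • (U * V))

@[simp] theorem lift_u : lift hU hV h (u d ζ a b) = U := by
  simp [lift, u]

@[simp] theorem lift_v : lift hU hV h (v d ζ a b) = V := by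
  simp [lift, v]
end

/-- Over an algebraic closure the relations are realised by a diagonal matrix and a weighted cyclic
permutation matrix. -/
theorem nontrivial_three (hζ : ζ ^ 2 + ζ + 1 = 0) : Nontrivial (SymbolAlgebra 3 ζ a b) := by
  obtain ⟨θ, hθ⟩ := IsAlgClosed.exists_pow_nat_eq (algebraMap L (AlgebraicClosure L) a)
    (n := 3) (by norm_num)
  set z := algebraMap L (AlgebraicClosure L) ζ with hz
  have hz0 : z ^ 2 + z + 1 = 0 := by
    rw [hz, ← map_pow, ← map_add, ← map_one (algebraMap L (AlgebraicClosure L)), ← map_add, hζ,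
      map_zero]
  have hz3 : z ^ 3 = 1 := by linear_combination (z - 1) * hz0
  let U : Matrix (Fin 3) (Fin 3) (AlgebraicClosure L) := !![θ, 0, 0; 0, θ * z ^ 2, 0; 0, 0, θ * z]
  let V : Matrix (Fin 3) (Fin 3) (AlgebraicClosure L) :=
    !![0, 0, algebraMap L (AlgebraicClosure L) b; 1, 0, 0; 0, 1, 0]
  have hU : U ^ 3 = a • 1 := by
    rw [← algebraMap_smul (AlgebraicClosure L) a (1 : Matrix (Fin 3) (Fin 3) (AlgebraicClosure L)),
      ← hθ]
    ext i j
    fin_cases i <;> fin_cases j <;>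
      simp [U, pow_succ, Matrix.mul_apply, Fin.sum_univ_three] <;> grind
  have hV : V ^ 3 = b • 1 := by
    rw [← algebraMap_smul (AlgebraicClosure L) b (1 : Matrix (Fin 3) (Fin 3) (AlgebraicClosure L))]
    ext i j
    fin_cases i <;> fin_cases j <;>
      simp [V, pow_succ, Matrix.mul_apply, Fin.sum_univ_three, Algebra.smul_def]
  have hVU : V * U = ζ • (U * V) := by
    rw [← algebraMap_smul (AlgebraicClosure L) ζ (U * V), ← hz]
    ext i j
    fin_cases i <;> fin_cases j <;>
      simp [U, V, Matrix.mul_apply, Fin.sum_univ_three] <;> grind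
  exact (lift hU hV hVU).toRingHom.domain_nontrivial

theorem isCentralSimple_three (hζ : ζ ^ 2 + ζ + 1 = 0) (h3 : (3 : L) ≠ 0) (ha : a ≠ 0)
    (hb : b ≠ 0) : IsCentralSimple L (SymbolAlgebra 3 ζ a b) := by
  have := nontrivial_three (a := a) (b := b) hζ
  refine isCentralSimple_of_symbol hζ h3 ha hb (u := u 3 ζ a b) (v := v 3 ζ a b) ?_ ?_
    (v_mul_u 3 ζ a b) (adjoin_eq_top 3 ζ a b)
  · rw [← u_pow, pow_succ, pow_two, mul_assoc]
  · rw [← v_pow, pow_succ, pow_two, mul_assoc]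

end SymbolAlgebra
end

/-! ### The universal property of the Clifford algebra -/

namespace CubicCoeffs
section
variable {F A : Type*} [Field F] [Ring A] [Algebra F A] {c : CubicCoeffs F} {ρ : F} {x y : A}

theorem aeval_Φ_eq (x y : A) (a b : F) :
    Polynomial.aeval (a • x + b • y) (c.Φ.map (MvPolynomial.eval ![a, b])) =
      a ^ 3 • (x ^ 3 - c.α • (1 : A)) +
      (a ^ 2 * b) • (x ^ 2 * y + x * y * x + y * x ^ 2 - c.r • x ^ 2 - c.e • x - c.β • (1 : A)) +
      (a * b ^ 2) • (x * y ^ 2 + y * x * y + y ^ 2 * x - c.r • (x * y + y * x) - c.e • y - c.t • x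
        - c.γ • (1 : A)) +
      b ^ 3 • (y ^ 3 - c.r • y ^ 2 - c.t • y - c.δ • (1 : A)) := by
  simp only [Φ, Polynomial.map_add, Polynomial.map_sub, Polynomial.map_mul, Polynomial.map_pow,
    Polynomial.map_X, Polynomial.map_C, map_sub, map_mul, map_pow, Polynomial.aeval_X,
    Polynomial.aeval_C, map_add, MvPolynomial.eval_C, MvPolynomial.eval_X,
    Matrix.cons_val_zero, Matrix.cons_val_one]
  simp only [Algebra.algebraMap_eq_smul_one, pow_succ (_ + _ : A), pow_succ x, pow_succ y,
    pow_zero, one_mul, mul_one, mul_add, add_mul, smul_pow, one_pow, smul_mul_assoc, mul_smul_comm,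
    mul_assoc, smul_smul, smul_add, smul_sub]
  match_scalars <;> ring

/-- The values of the form `Φ(ax + by, a, b)` at `(1, 0)`, `(0, 1)`, `(1, 1)` and `(ρ, 1)` already
determine its coefficients, so no assumption on the size of `F` is needed. -/
theorem cliffordPair_iff (hρ : ρ ^ 2 + ρ + 1 = 0) (h3 : (3 : F) ≠ 0) :
    c.CliffordPair x y ↔ ∀ a b : F,
      Polynomial.aeval (a • x + b • y) (c.Φ.map (MvPolynomial.eval ![a, b])) = 0 := by
  simp only [aeval_Φ_eq]
  constructor
  · intro h a b
    rw [h.xxx, h.xxy, h.xyy, h.yyy]; simp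
  · intro h
    set X := x ^ 3 - c.α • (1 : A)
    set Y := y ^ 3 - c.r • y ^ 2 - c.t • y - c.δ • (1 : A)
    set P := x ^ 2 * y + x * y * x + y * x ^ 2 - c.r • x ^ 2 - c.e • x - c.β • (1 : A)
    set Q := x * y ^ 2 + y * x * y + y ^ 2 * x - c.r • (x * y + y * x) - c.e • y - c.t • x
        - c.γ • (1 : A)
    have hX : X = 0 := by simpa using h 1 0
    have hY : Y = 0 := by simpa using h 0 1
    have h1 : P + Q = 0 := by simpa [hX, hY] using h 1 1
    have h2 : ρ ^ 2 • P + ρ • Q = 0 := by simpa [hX, hY] using h ρ 1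
    have hQ : Q = -P := by rw [eq_neg_iff_add_eq_zero, add_comm, h1]
    have hne : ρ ^ 2 - ρ ≠ 0 := by
      intro h0
      exact h3 (by linear_combination (3 - 2 * ρ) * hρ + (2 * ρ + 1) * h0)
    rw [hQ, smul_neg, ← sub_eq_add_neg, ← sub_smul] at h2
    have hP : P = 0 := (smul_eq_zero_iff_right hne).1 h2
    exact ⟨hX, hP, by rw [← neg_eq_zero, ← hQ] at hP; exact hP, hY⟩
end

section
variable {F : Type*} [Field F] {c : CubicCoeffs F} {ρ : F}

theorem cliffordPair_gen (hρ : ρ ^ 2 + ρ + 1 = 0) (h3 : (3 : F) ≠ 0) : c.CliffordPair c.x c.y := by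
  refine (cliffordPair_iff hρ h3).2 fun a b => ?_
  have h := RingQuot.mkAlgHom_rel F (GenCliffordRel.root (Φ := c.Φ) ![a, b])
  rw [← Polynomial.aeval_algHom_apply, map_zero] at h
  simpa [Fin.sum_univ_two, x, y, GenClifford.gen] using h

theorem adjoin_gen : Algebra.adjoin F {c.x, c.y} = ⊤ := by
  have h : Set.range (FreeAlgebra.ι F : Fin 2 → FreeAlgebra F (Fin 2)) =
      {FreeAlgebra.ι F 0, FreeAlgebra.ι F 1} := by
    ext z; simp [Fin.exists_fin_two, eq_comm]
  have h' := congrArg (Subalgebra.map (RingQuot.mkAlgHom F (GenCliffordRel c.Φ)))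
    (FreeAlgebra.adjoin_range_ι (R := F) (X := Fin 2))
  rw [AlgHom.map_adjoin, h, Algebra.map_top, Set.image_pair,
    (AlgHom.range_eq_top _).2 (RingQuot.mkAlgHom_surjective _ _)] at h'
  exact h'

theorem exists_lift (hρ : ρ ^ 2 + ρ + 1 = 0) (h3 : (3 : F) ≠ 0) {A : Type*} [Ring A] [Algebra F A]
    {X Y : A} (h : c.CliffordPair X Y) : ∃ f : GenClifford c.Φ →ₐ[F] A, f c.x = X ∧ f c.y = Y := by
  refine ⟨RingQuot.liftAlgHom F ⟨FreeAlgebra.lift F ![X, Y], ?_⟩, ?_, ?_⟩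
  · rintro _ _ ⟨a⟩
    have := (cliffordPair_iff hρ h3).1 h (a 0) (a 1)
    rw [map_zero, ← Polynomial.aeval_algHom_apply, ← this]
    congr 2
    · simp [Fin.sum_univ_two]
    · congr 2
      ext i; fin_cases i <;> rfl
  · simp [x, GenClifford.gen]
  · simp [y, GenClifford.gen]

theorem yComp_eq (k : ℕ) : c.yComp ρ k = c.component ρ c.x c.y k := rfl

theorem w_eq : c.w ρ = c.wOf ρ c.x (c.component ρ c.x c.y 1) (c.component ρ c.x c.y 2) := rfl

variable {A B : Type*} [Ring A] [Algebra F A] [Ring B] [Algebra F B] (f : A →ₐ[F] B)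

theorem map_component (X Y : A) (k : ℕ) :
    f (c.component ρ X Y k) = c.component ρ (f X) (f Y) k := by
  simp [component, map_sum]

theorem map_wOf (X Y Z : A) : f (c.wOf ρ X Y Z) = c.wOf ρ (f X) (f Y) (f Z) := by
  simp [wOf]

theorem CliffordPair.map {X Y : A} (h : c.CliffordPair X Y) : c.CliffordPair (f X) (f Y) where
  xxx := by simpa using congrArg f h.xxx
  xxy := by simpa using congrArg f h.xxy
  xyy := by simpa using congrArg f h.xyy
  yyy := by simpa using congrArg f h.yyy

end
end CubicCoeffs

/-! ### Points of the curve and their residue fields -/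

section

theorem subalgebra_eq_top_of_tower {F K B : Type*} [Field F] [Field K] [Ring B] [Algebra F K]
    [Algebra K B] [Algebra F B] [IsScalarTower F K B] {s : Set K} {t : Set B}
    (hs : Algebra.adjoin F s = ⊤) (ht : Algebra.adjoin K t = ⊤) {M : Subalgebra F B}
    (hsM : ∀ k ∈ s, algebraMap K B k ∈ M) (htM : t ⊆ M) : M = ⊤ := by
  have hK : ∀ k, algebraMap K B k ∈ M := by
    have : Algebra.adjoin F s ≤ M.comap (IsScalarTower.toAlgHom F K B) :=
      Algebra.adjoin_le fun k hk => hsM k hk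
    intro k
    exact this (hs ▸ Algebra.mem_top)
  refine eq_top_iff.2 fun z _ => ?_
  have hz : z ∈ Algebra.adjoin K t := ht ▸ Algebra.mem_top
  induction hz using Algebra.adjoin_induction with
  | mem g hg => exact htM hg
  | algebraMap r => exact hK r
  | add a b _ _ ha hb => exact add_mem (ha trivial) (hb trivial)
  | mul a b _ _ ha hb => exact mul_mem (ha trivial) (hb trivial)

namespace CubicCoeffs

variable {F : Type*} [Field F] {c : CubicCoeffs F} {ρ : F}

/-- The expression is the norm of `R x - p x² - q` from the field `F[x : x³ = α]`, and `1`, `x`,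
`x²` are linearly independent over `F`. -/
theorem cubicNorm_ne_zero (hρ : ρ ^ 2 + ρ + 1 = 0)
    (hx : IsField (AdjoinRoot (Polynomial.X ^ 3 - Polynomial.C c.α : Polynomial F)))
    {R p q : F} (hR : R ≠ 0) :
    c.α * R ^ 3 - (c.α ^ 2 * p ^ 3 + q ^ 3) - 3 * c.α * p * q * R ≠ 0 := by
  intro h
  set f : Polynomial F := Polynomial.X ^ 3 - Polynomial.C c.α with hf
  have := hx.isDomain
  have hρ0 : ρ ≠ 0 := by rintro rfl; simp at hρ
  let g (i : ℕ) : Polynomial F := Polynomial.C (R * ρ ^ i) * Polynomial.X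
    - Polynomial.C (p * ρ ^ (2 * i)) * Polynomial.X ^ 2 - Polynomial.C q
  have hdeg : f.natDegree = 3 := by rw [hf]; compute_degree!
  have hg (i : ℕ) : ¬ f ∣ g i := by
    intro hd
    have h0 : g i = 0 := by
      refine Polynomial.eq_zero_of_dvd_of_natDegree_lt hd ?_
      rw [hdeg]
      refine lt_of_le_of_lt (b := 2) ?_ (by norm_num)
      simp only [g]; compute_degree
    have h1 := congrArg (fun P => Polynomial.coeff P 1) h0
    simp only [g, Polynomial.coeff_sub, Polynomial.coeff_C_mul, Polynomial.coeff_X_one,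
      Polynomial.coeff_X_pow, Polynomial.coeff_C, Polynomial.coeff_zero] at h1
    norm_num [hR, hρ0] at h1
  -- `g i` is `h(ρⁱ X)`, and the product of these conjugates is the norm modulo `X³ - α`.
  have hprod : f ∣ g 0 * g 1 * g 2 := by
    have e : (Polynomial.C ρ : Polynomial F) ^ 2 + Polynomial.C ρ + 1 = 0 := by
      rw [← map_pow, ← map_add, ← map_one Polynomial.C, ← map_add, hρ, map_zero]
    have h' : Polynomial.C c.α * Polynomial.C R ^ 3 - (Polynomial.C c.α ^ 2 * Polynomial.C p ^ 3
        + Polynomial.C q ^ 3) - 3 * Polynomial.C c.α * Polynomial.C p * Polynomial.C q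
          * Polynomial.C R = 0 := by
      have := congrArg Polynomial.C h
      simpa only [map_sub, map_mul, map_add, map_pow, map_zero, map_ofNat] using this
    refine ⟨Polynomial.C R ^ 3 - Polynomial.C p ^ 3 * (Polynomial.X ^ 3 + Polynomial.C c.α)
      - 3 * Polynomial.C p * Polynomial.C q * Polynomial.C R, ?_⟩
    simp only [g, hf, map_mul, map_pow]
    generalize Polynomial.C ρ = z at *
    set A := Polynomial.C R * (Polynomial.X : Polynomial F) with hA
    set B := -(Polynomial.C p * (Polynomial.X : Polynomial F) ^ 2) with hB
    set C := -Polynomial.C q with hC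
    linear_combination h' + (A + B + C) * (A ^ 2 * (z - 1) + B ^ 2 * (z ^ 3 + 1) * (z - 1)
      + A * B * (z ^ 3 - z + 1) + A * C + B * C * (z ^ 2 - z + 1)) * e
  rw [← AdjoinRoot.mk_eq_zero, map_mul, map_mul, mul_eq_zero, mul_eq_zero, AdjoinRoot.mk_eq_zero,
    AdjoinRoot.mk_eq_zero, AdjoinRoot.mk_eq_zero] at hprod
  rcases hprod with (h | h) | h
  · exact hg 0 h
  · exact hg 1 h
  · exact hg 2 h

/-- If `S = 0` and `ρ² e R = D`, then `R` is a nonzero element of `F`, at which the cubic norm does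
not vanish. -/
theorem linear_ne_zero_of_S_eq_zero (h3 : (3 : F) ≠ 0) (hα : c.α ≠ 0) (hρ : ρ ^ 2 + ρ + 1 = 0)
    (hD : c.D ≠ 0)
    (hx : IsField (AdjoinRoot (Polynomial.X ^ 3 - Polynomial.C c.α : Polynomial F)))
    {K : Type*} [Field K] [Algebra F K] {R S : K} (h : c.curveEq ρ R S = 0) (hS : S = 0) :
    algebraMap F K (ρ ^ 2 * c.e) * R - algebraMap F K c.D ≠ 0 := by
  intro h0
  have he : ρ ^ 2 * c.e ≠ 0 := by
    intro he
    rw [he, map_zero, zero_mul, zero_sub, neg_eq_zero, map_eq_zero] at h0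
    exact hD h0
  have hR : R = algebraMap F K (c.D / (ρ ^ 2 * c.e)) := by
    rw [map_div₀, eq_div_iff ((map_ne_zero _).2 he), mul_comm, ← sub_eq_zero, h0]
  rw [curveEq_eq h3 hα hρ, hS, hR, mul_zero, sub_zero, ← map_pow, ← map_mul, ← map_mul, ← map_sub,
    ← map_sub, map_eq_zero] at h
  exact cubicNorm_ne_zero hρ hx (div_ne_zero hD he) h

namespace Point

variable (P : c.Point ρ)

theorem adjoin_eq_top : Algebra.adjoin F {P.R₀, P.S₀} = ⊤ := by
  have h := IntermediateField.adjoin_toSubalgebra_of_isAlgebraic (F := F)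
    (S := {P.R, P.S}) fun z _ => Algebra.IsAlgebraic.isAlgebraic z
  have hinj : Function.Injective P.field.val := P.field.val.injective
  apply Subalgebra.map_injective hinj
  rw [AlgHom.map_adjoin, Set.image_pair, Algebra.map_top]
  change Algebra.adjoin F {P.R, P.S} = _
  rw [← h]
  ext z
  simp only [IntermediateField.mem_toSubalgebra, AlgHom.mem_range]
  exact ⟨fun hz => ⟨⟨z, hz⟩, rfl⟩, fun ⟨w, hw⟩ => hw ▸ w.2⟩

theorem coe_aeval (f : MvPolynomial (Fin 2) F) :
    P.field.val (MvPolynomial.aeval ![P.R₀, P.S₀] f) = MvPolynomial.aeval ![P.R, P.S] f := by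
  have : P.field.val.comp (MvPolynomial.aeval ![P.R₀, P.S₀]) = MvPolynomial.aeval ![P.R, P.S] := by
    apply MvPolynomial.algHom_ext
    intro i; fin_cases i <;> simp <;> rfl
  rw [← this]; rfl

theorem aeval_eq_zero {f : MvPolynomial (Fin 2) F} (h : MvPolynomial.aeval ![P.R, P.S] f = 0) :
    MvPolynomial.aeval ![P.R₀, P.S₀] f = 0 := by
  rw [← P.coe_aeval] at h
  exact (map_eq_zero P.field.val).1 h

/-- Homomorphisms out of the residue field are determined by polynomial identities: `F(R₀, S₀)` is
the quotient of `F[X, Y]` by the polynomials that vanish at the point. -/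
theorem exists_algHom {B : Type*} [CommRing B] [Algebra F B] (W S : B)
    (h : ∀ f : MvPolynomial (Fin 2) F, MvPolynomial.aeval ![P.R, P.S] f = 0 →
      MvPolynomial.aeval ![W, S] f = 0) :
    ∃ φ : P.field →ₐ[F] B, φ P.R₀ = W ∧ φ P.S₀ = S := by
  let g : MvPolynomial (Fin 2) F →ₐ[F] P.field := MvPolynomial.aeval ![P.R₀, P.S₀]
  have hg : Function.Surjective g := by
    rw [← AlgHom.range_eq_top, ← Algebra.adjoin_range_eq_range_aeval, ← P.adjoin_eq_top]
    congr 1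
    ext z; simp [or_comm]
  have hker : RingHom.ker g.toRingHom ≤
      RingHom.ker (MvPolynomial.aeval (R := F) ![W, S]).toRingHom := by
    intro f hf
    refine h f ?_
    rw [← P.coe_aeval, show MvPolynomial.aeval ![P.R₀, P.S₀] f = 0 from hf, map_zero]
  refine ⟨AlgHom.liftOfSurjective g hg (MvPolynomial.aeval ![W, S]) hker, ?_, ?_⟩
  · have := AlgHom.liftOfSurjective_apply g hg (MvPolynomial.aeval ![W, S]) hker (MvPolynomial.X 0)
    simpa [g] using this
  · have := AlgHom.liftOfSurjective_apply g hg (MvPolynomial.aeval ![W, S]) hker (MvPolynomial.X 1)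
    simpa [g] using this

variable {P}

/-- An embedding of the residue field into the closure extends to an automorphism of the closure. -/
theorem orbit_eq_of_algHom {P' : c.Point ρ} (φ : P.field →ₐ[F] AlgebraicClosure F)
    (hR : φ P.R₀ = P'.R) (hS : φ P.S₀ = P'.S) : P.orbit = P'.orbit := by
  obtain ⟨σ, hσ⟩ := IntermediateField.exists_algHom_of_splits (F := F) (E := AlgebraicClosure F)
    (K := AlgebraicClosure F) (fun z => ⟨Algebra.IsIntegral.isIntegral z, IsAlgClosed.splits _⟩) φ
  have hσR : σ P.R = P'.R := by rw [← hR, ← hσ]; rfl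
  have hσS : σ P.S = P'.S := by rw [← hS, ← hσ]; rfl
  symm
  refine Quotient.sound ⟨AlgEquiv.ofBijective σ (Algebra.IsAlgebraic.algHom_bijective σ), ?_⟩
  exact Subtype.ext (Prod.ext hσR hσS)

end Point
end CubicCoeffs
end

/-! ### The point under a simple image -/

section
namespace CubicCoeffs

variable {F : Type*} [Field F] {c : CubicCoeffs F} {ρ : F}

theorem mem_center_of_adjoin_eq_top {A : Type*} [Ring A] [Algebra F A] {s : Set A} {z : A}
    (hs : Algebra.adjoin F s = ⊤) (h : ∀ g ∈ s, z * g = g * z) : z ∈ Subalgebra.center F A := by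
  rw [Subalgebra.mem_center_iff]
  intro b
  have : Algebra.adjoin F s ≤ Subalgebra.centralizer F {z} :=
    Algebra.adjoin_le fun g hg => Subalgebra.mem_centralizer_iff F |>.2 (by
      rintro _ rfl; exact h g hg)
  exact ((Subalgebra.mem_centralizer_iff F).1 (this (hs ▸ Algebra.mem_top (x := b))) z rfl).symm

section
variable {A : Type*} [Ring A] [Algebra F A] {x y₁ y₂ : A}

theorem IsGradedTriple.w_mem_center (h : c.IsGradedTriple ρ x y₁ y₂) (hρ : ρ ^ 2 + ρ + 1 = 0)
    (hα : c.α ≠ 0) (hgen : Algebra.adjoin F {x, y₁, y₂} = ⊤) :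
    c.wOf ρ x y₁ y₂ ∈ Subalgebra.center F A := by
  refine mem_center_of_adjoin_eq_top hgen ?_
  rintro g (rfl | rfl | rfl)
  exacts [h.commute_w_x hρ hα, h.commute_w_y₁ hρ hα, h.commute_w_y₂ hρ hα]

theorem IsGradedTriple.y₁_cube_mem_center (h : c.IsGradedTriple ρ x y₁ y₂)
    (hρ : ρ ^ 2 + ρ + 1 = 0) (hgen : Algebra.adjoin F {x, y₁, y₂} = ⊤) :
    y₁ ^ 3 ∈ Subalgebra.center F A := by
  refine mem_center_of_adjoin_eq_top hgen ?_
  rintro g (rfl | rfl | rfl)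
  exacts [h.commute_y₁_cube_x hρ, by rw [← pow_succ, ← pow_succ'], h.commute_y₁_cube_y₂ hρ]

theorem IsGradedTriple.curve (h : c.IsGradedTriple ρ x y₁ y₂) (hρ : ρ ^ 2 + ρ + 1 = 0)
    (hα : c.α ≠ 0) :
    c.α • c.wOf ρ x y₁ y₂ ^ 3 - (c.α ^ 2 * c.p ρ ^ 3 + c.q ^ 3) • (1 : A)
      - (3 * c.α * c.p ρ * c.q) • c.wOf ρ x y₁ y₂
      - ((ρ ^ 2 * c.e) • c.wOf ρ x y₁ y₂ - c.D • (1 : A) - y₁ ^ 3) * y₁ ^ 3 = 0 := by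
  rw [← h.y₂_cube, mul_pow_three_eq hρ h.cube h.mul₂ (h.mul₂₁ hα) (h.commute_w_x hρ hα)
    (h.commute_w_y₁ hρ hα), sub_self]

theorem IsGradedTriple.y₂_mul_y₁_cube (h : c.IsGradedTriple ρ x y₁ y₂) (hα : c.α ≠ 0) :
    y₂ * y₁ ^ 3 = (x * c.wOf ρ x y₁ y₂ - c.p ρ • (x * x) - c.q • (1 : A)) * (y₁ * y₁) := by
  rw [← h.mul₂₁ hα, pow_succ', pow_two, mul_assoc]

/-- In a simple image the classes of `w` and `y₁ ^ 3` are the coordinates of a point of `E`. The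
centre `Z` is a field, integral over `F[w, s]` because the algebra is a finite module over it, so
the kernel of `F[X, Y] → Z` is a maximal ideal. -/
theorem exists_point_of_isSimpleRing [IsSimpleRing A] (h : c.IsGradedTriple ρ x y₁ y₂)
    (h3 : (3 : F) ≠ 0) (hρ : ρ ^ 2 + ρ + 1 = 0) (hα : c.α ≠ 0)
    (hgen : Algebra.adjoin F {x, y₁, y₂} = ⊤) :
    ∃ (P : c.Point ρ) (φ : P.field →ₐ[F] A), (∀ k a, φ k * a = a * φ k) ∧
      φ P.R₀ = c.wOf ρ x y₁ y₂ ∧ φ P.S₀ = y₁ ^ 3 := by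
  set Z := Subalgebra.center F A with hZ
  let W : Z := ⟨c.wOf ρ x y₁ y₂, h.w_mem_center hρ hα hgen⟩
  let S : Z := ⟨y₁ ^ 3, h.y₁_cube_mem_center hρ hgen⟩
  let g : MvPolynomial (Fin 2) F →ₐ[F] Z := MvPolynomial.aeval ![W, S]
  have hgX0 : (g (MvPolynomial.X 0) : A) = c.wOf ρ x y₁ y₂ := by simp [g, W]
  have hgX1 : (g (MvPolynomial.X 1) : A) = y₁ ^ 3 := by simp [g, S]
  have hcomm (k : Z) (a : A) : (k : A) * a = a * k := (Subalgebra.mem_center_iff.1 k.2 a).symm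
  -- `A` as an algebra over `F[X, Y]`, where `X` acts as `w` and `Y` as `y₁ ^ 3`.
  let algA : Algebra (MvPolynomial (Fin 2) F) A :=
    (Z.val.comp g).toRingHom.toAlgebra' fun k a => hcomm (g k) a
  have hsmul (k : MvPolynomial (Fin 2) F) (a : A) : k • a = g k * a := Algebra.smul_def k a
  have hC (r : F) (a : A) : (MvPolynomial.C r : MvPolynomial (Fin 2) F) • a = r • a := by
    rw [hsmul, ← MvPolynomial.algebraMap_eq, AlgHom.commutes, Algebra.smul_def]; rfl
  have : IsScalarTower F (MvPolynomial (Fin 2) F) A := by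
    refine IsScalarTower.of_algebraMap_eq fun r => ?_
    change _ = ((g (algebraMap F _ r) : Z) : A)
    rw [AlgHom.commutes]; rfl
  have hmul₂₁ : y₂ * y₁ ∈ spanCube (MvPolynomial (Fin 2) F) x := by
    refine mem_spanCube.2 ⟨-MvPolynomial.C c.q, MvPolynomial.X 0, -MvPolynomial.C (c.p ρ), ?_⟩
    rw [h.mul₂₁ hα, neg_smul, neg_smul, hC, hC, hsmul, hgX0, h.commute_w_x hρ hα]
    abel
  have hfin : Module.Finite (MvPolynomial (Fin 2) F) A := by
    refine finite_of_graded (ζ₁ := MvPolynomial.C ρ) (ζ₂ := MvPolynomial.C (ρ ^ 2))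
      (α := MvPolynomial.C c.α) (s := MvPolynomial.X 1)
      (t := MvPolynomial.C (ρ ^ 2 * c.e) * MvPolynomial.X 0 - MvPolynomial.C c.D - MvPolynomial.X 1)
      (by rw [hC, h.cube]) (by rw [hC, h.mul₁]) (by rw [hC, h.mul₂]) ?_ hmul₂₁ ?_ ?_ ?_
    · rw [h.mul₁₂, ← hC, ← hC, ← hC]
      refine add_mem (add_mem ?_ ?_) ?_ <;> apply Submodule.smul_mem
      · exact hmul₂₁
      · exact Submodule.subset_span (by simp)
      · exact one_mem_spanCube x
    · rw [hsmul, hgX1, mul_one, pow_succ, pow_two, mul_assoc]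
    · rw [sub_smul, sub_smul, mul_smul, hC, hC, hsmul, hsmul, hgX0, hgX1, mul_one, mul_one,
        ← h.y₂_cube, pow_succ, pow_two, mul_assoc]
    · rw [eq_top_iff]
      intro z _
      have hz : z ∈ Algebra.adjoin F {x, y₁, y₂} := hgen ▸ Algebra.mem_top
      have hle : Algebra.adjoin F {x, y₁, y₂} ≤
          (Algebra.adjoin (MvPolynomial (Fin 2) F) {x, y₁, y₂}).restrictScalars F :=
        Algebra.adjoin_le Algebra.subset_adjoin
      exact hle hz
  have hfield : IsField Z := IsSimpleRing.isField_center A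
  have hint : g.toRingHom.IsIntegral := by
    intro z
    let algZ : Algebra (MvPolynomial (Fin 2) F) Z := g.toRingHom.toAlgebra
    let val : Z →ₐ[MvPolynomial (Fin 2) F] A := { Z.val.toRingHom with commutes' := fun _ => rfl }
    exact (isIntegral_algHom_iff val Subtype.val_injective).1
      (IsIntegral.of_finite (MvPolynomial (Fin 2) F) (val z))
  have hbot : (⊥ : Ideal Z).IsMaximal := by
    let := hfield.toField
    exact Ideal.bot_isMaximal
  -- `Z` is a field integral over the image of `g`, so that image is a field too.
  have hmax : (RingHom.ker g).IsMaximal :=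
    Ideal.isMaximal_comap_of_isIntegral_of_isMaximal' g.toRingHom hint ⊥
  let K := MvPolynomial (Fin 2) F ⧸ RingHom.ker g
  let : Field K := Ideal.Quotient.field _
  have : Module.Finite F K := finite_of_finite_type_of_isJacobsonRing F K
  let ψ : K →ₐ[F] AlgebraicClosure F := IsAlgClosed.lift
  let mk : MvPolynomial (Fin 2) F →ₐ[F] K := Ideal.Quotient.mkₐ F _
  let ι : K →ₐ[F] Z := Ideal.Quotient.liftₐ _ g fun a ha => ha
  have hι (f) : ι (mk f) = g f := rfl
  have hinj : Function.Injective ι := RingHom.injective ι.toRingHom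
  -- The curve equation is transported to `K` along the inclusion of `K` in the centre.
  have hcurveK : c.curveEq ρ (mk (MvPolynomial.X 0)) (mk (MvPolynomial.X 1)) = 0 := by
    have h0 := h.curve hρ hα
    rw [← hgX0, ← hgX1] at h0
    set W' := g (MvPolynomial.X 0)
    set S' := g (MvPolynomial.X 1)
    have hZ0 : c.α • W' ^ 3 - (c.α ^ 2 * c.p ρ ^ 3 + c.q ^ 3) • (1 : Z)
      - (3 * c.α * c.p ρ * c.q) • W' - ((ρ ^ 2 * c.e) • W' - c.D • (1 : Z) - S') * S' = 0 :=
      Subtype.ext h0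
    apply hinj
    rw [curveEq_eq h3 hα hρ, map_zero, ← hZ0]
    simp only [map_sub, map_mul, map_pow, AlgHom.commutes, hι, Algebra.smul_def, mul_one]
    rfl
  have hcurve : c.curveEq ρ (ψ (mk (MvPolynomial.X 0))) (ψ (mk (MvPolynomial.X 1))) = 0 := by
    rw [← map_zero ψ, ← hcurveK]
    simp only [curveEq, map_sub, map_mul, map_pow, map_add, AlgHom.commutes]
  let P : c.Point ρ := ⟨(_, _), hcurve⟩
  obtain ⟨φ, hφR, hφS⟩ := P.exists_algHom W S fun f hf => by
    have e : (MvPolynomial.aeval ![P.R, P.S] : _ →ₐ[F] AlgebraicClosure F) = ψ.comp mk := by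
      apply MvPolynomial.algHom_ext
      intro i; fin_cases i <;> simp <;> rfl
    rw [e] at hf
    have : mk f = 0 := (map_eq_zero ψ).1 hf
    have := congrArg ι this
    rwa [hι, map_zero] at this
  refine ⟨P, Z.val.comp φ, fun k a => hcomm (φ k) a, ?_, ?_⟩
  · simp only [AlgHom.comp_apply, hφR]; rfl
  · simp only [AlgHom.comp_apply, hφS]; rfl
end
end CubicCoeffs
end

/-! ### The simple image above a point -/

section
namespace CubicCoeffs

variable {F : Type u} [Field F] {c : CubicCoeffs F} {ρ : F}

/-- The quotient map onto a simple image. -/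
def quotientMap (I : SimpleImage (GenClifford c.Φ)) :
    GenClifford c.Φ →ₐ[F] I.1.ringCon.Quotient := RingCon.mkₐ F I.1.ringCon

theorem quotientMap_surjective (I : SimpleImage (GenClifford c.Φ)) :
    Function.Surjective (quotientMap I) := RingCon.mk'_surjective _

theorem ker_quotientMap (I : SimpleImage (GenClifford c.Φ)) :
    TwoSidedIdeal.ker (quotientMap I) = I.1 := TwoSidedIdeal.ker_ringCon_mk' I.1

theorem adjoin_components {A : Type*} [Ring A] [Algebra F A] {f : GenClifford c.Φ →ₐ[F] A}
    (hρ : ρ ^ 2 + ρ + 1 = 0) (h3 : (3 : F) ≠ 0) (hα : c.α ≠ 0) (hf : Function.Surjective f) :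
    Algebra.adjoin F {f c.x, f (c.yComp ρ 1), f (c.yComp ρ 2)} = ⊤ := by
  have hy := ((cliffordPair_gen (c := c) hρ h3).isGradedTriple hρ h3 hα).2
  rw [← yComp_eq, ← yComp_eq] at hy
  have h : Algebra.adjoin F {c.x, c.yComp ρ 1, c.yComp ρ 2} = ⊤ := by
    set M := Algebra.adjoin F {c.x, c.yComp ρ 1, c.yComp ρ 2} with hM
    have hx : c.x ∈ M := Algebra.subset_adjoin (by simp)
    rw [eq_top_iff, ← adjoin_gen]
    refine Algebra.adjoin_le ?_
    rintro g (rfl | rfl)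
    · exact hx
    · rw [SetLike.mem_coe, hy, y₀Of]
      refine add_mem (add_mem (add_mem (add_mem ?_ ?_) ?_) ?_) ?_
      · exact M.smul_mem (one_mem M) _
      · exact M.smul_mem hx _
      · exact M.smul_mem (mul_mem hx hx) _
      · exact Algebra.subset_adjoin (by simp)
      · exact Algebra.subset_adjoin (by simp)
  have h' := congrArg (Subalgebra.map f) h
  rwa [AlgHom.map_adjoin, Set.image_insert_eq, Set.image_pair, Algebra.map_top,
    (AlgHom.range_eq_top _).2 hf] at h'

theorem isGradedTriple_map {A : Type*} [Ring A] [Algebra F A] (f : GenClifford c.Φ →ₐ[F] A)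
    (hρ : ρ ^ 2 + ρ + 1 = 0) (h3 : (3 : F) ≠ 0) (hα : c.α ≠ 0) :
    c.IsGradedTriple ρ (f c.x) (f (c.yComp ρ 1)) (f (c.yComp ρ 2)) ∧
      f c.y = c.y₀Of (f c.x) + f (c.yComp ρ 1) + f (c.yComp ρ 2) := by
  simp only [yComp_eq, map_component]
  exact ((cliffordPair_gen hρ h3).map f).isGradedTriple hρ h3 hα

theorem map_w {A : Type*} [Ring A] [Algebra F A] (f : GenClifford c.Φ →ₐ[F] A) :
    f (c.w ρ) = c.wOf ρ (f c.x) (f (c.yComp ρ 1)) (f (c.yComp ρ 2)) := by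
  rw [w_eq, map_wOf]; rfl

namespace Point

/-- The point `P` lies under the simple image `I` if `w` and `y₁ ^ 3` act in `C_Φ / I` as its
coordinates: there is a central embedding of the residue field of `P` that sends `R₀` and `S₀` to
their classes. -/
def LiesUnder (P : c.Point ρ) (I : SimpleImage (GenClifford c.Φ)) : Prop :=
  ∃ φ : P.field →ₐ[F] I.1.ringCon.Quotient, (∀ k a, φ k * a = a * φ k) ∧
    φ P.R₀ = quotientMap I (c.w ρ) ∧ φ P.S₀ = quotientMap I (c.yComp ρ 1 ^ 3)

theorem exists_liesUnder (h3 : (3 : F) ≠ 0) (hρ : ρ ^ 2 + ρ + 1 = 0) (hα : c.α ≠ 0)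
    (I : SimpleImage (GenClifford c.Φ)) : ∃ P : c.Point ρ, P.LiesUnder I := by
  have := I.2
  obtain ⟨P, φ, h, hR, hS⟩ := exists_point_of_isSimpleRing
    (isGradedTriple_map (quotientMap I) hρ h3 hα).1 h3 hρ hα
    (adjoin_components hρ h3 hα (quotientMap_surjective I))
  exact ⟨P, φ, h, by rw [hR, map_w], by rw [hS, map_pow]⟩

theorem LiesUnder.of_orbit_eq {P P' : c.Point ρ} {I : SimpleImage (GenClifford c.Φ)}
    (h : P.LiesUnder I) (hP : P.orbit = P'.orbit) : P'.LiesUnder I := by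
  obtain ⟨σ, rfl⟩ := Quotient.exact hP.symm
  obtain ⟨ψ, hψR, hψS⟩ := (σ • P).exists_algHom P.R₀ P.S₀ fun f hf => by
    apply P.aeval_eq_zero
    have e : MvPolynomial.aeval ![(σ • P).R, (σ • P).S] =
        σ.toAlgHom.comp (MvPolynomial.aeval ![P.R, P.S]) := by
      apply MvPolynomial.algHom_ext
      intro i; fin_cases i <;> simp <;> rfl
    rw [e] at hf
    exact (map_eq_zero σ).1 hf
  obtain ⟨φ, hφ, hφR, hφS⟩ := h
  exact ⟨φ.comp ψ, fun k a => hφ _ _, by rw [← hφR, ← hψR]; rfl, by rw [← hφS, ← hψS]; rfl⟩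

theorem LiesUnder.orbit_eq {P P' : c.Point ρ} {I : SimpleImage (GenClifford c.Φ)}
    (h : P.LiesUnder I) (h' : P'.LiesUnder I) : P.orbit = P'.orbit := by
  obtain ⟨φ, -, hφR, hφS⟩ := h
  obtain ⟨φ', -, hφR', hφS'⟩ := h'
  have := I.2
  have e : φ.comp (MvPolynomial.aeval ![P.R₀, P.S₀]) =
      φ'.comp (MvPolynomial.aeval ![P'.R₀, P'.S₀]) := by
    apply MvPolynomial.algHom_ext
    intro i; fin_cases i
    · simp [hφR, hφR']
    · simp [hφS, hφS']
  obtain ⟨ψ, hψR, hψS⟩ := P.exists_algHom P'.R P'.S fun f hf => by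
    have h0 := DFunLike.congr_fun e f
    rw [AlgHom.comp_apply, AlgHom.comp_apply, P.aeval_eq_zero hf, map_zero] at h0
    rw [← P'.coe_aeval, (map_eq_zero φ').1 h0.symm, map_zero]
  exact orbit_eq_of_algHom ψ hψR hψS

/-- Let `B` be a simple algebra over the residue field of `P`, generated by a graded triple with
`w = R₀` and `y₁ ^ 3 = S₀` that is universal among such triples. Then `C_Φ` has exactly one simple
image above `P`, and this image is `B`: for any image `J` above `P` the projection `C_Φ → C_Φ / J`
factors through `B`, by an injective map since `B` is simple. -/
theorem exists_image_of_model (h3 : (3 : F) ≠ 0) (hρ : ρ ^ 2 + ρ + 1 = 0) (hα : c.α ≠ 0)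
    (P : c.Point ρ) {B : Type*} [Ring B] [Algebra F B] [Algebra P.field B]
    [IsScalarTower F P.field B] [IsSimpleRing B] {x y₁ y₂ : B} (h : c.IsGradedTriple ρ x y₁ y₂)
    (hw : c.wOf ρ x y₁ y₂ = P.R₀ • (1 : B)) (hs : y₁ ^ 3 = P.S₀ • (1 : B))
    (hgen : Algebra.adjoin P.field {x, y₁, y₂} = ⊤)
    (huniv : ∀ (Q : Type u) [Ring Q] [Algebra F Q] [Algebra P.field Q] [IsScalarTower F P.field Q]
      (x' y₁' y₂' : Q), c.IsGradedTriple ρ x' y₁' y₂' → c.wOf ρ x' y₁' y₂' = P.R₀ • (1 : Q) →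
      y₁' ^ 3 = P.S₀ • (1 : Q) → ∃ g : B →ₐ[P.field] Q, g x = x' ∧ g y₁ = y₁' ∧ g y₂ = y₂') :
    ∃ I : SimpleImage (GenClifford c.Φ), P.LiesUnder I ∧ P.Yields I B ∧
      ∀ J, P.LiesUnder J → J = I := by
  obtain ⟨f, hfx, hfy⟩ := exists_lift hρ h3 (h.cliffordPair hρ h3 hα)
  obtain ⟨hc₁, hc₂⟩ := component_of_graded h.cube h.mul₁ h.mul₂ hα hρ h3
  have hf₁ : f (c.yComp ρ 1) = y₁ := by rw [yComp_eq, map_component, hfx, hfy, hc₁]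
  have hf₂ : f (c.yComp ρ 2) = y₂ := by rw [yComp_eq, map_component, hfx, hfy, hc₂]
  have hfw : f (c.w ρ) = algebraMap P.field B P.R₀ := by
    rw [map_w, hfx, hf₁, hf₂, hw, Algebra.algebraMap_eq_smul_one]
  have hfs : f (c.yComp ρ 1 ^ 3) = algebraMap P.field B P.S₀ := by
    rw [map_pow, hf₁, hs, Algebra.algebraMap_eq_smul_one]
  have hsurj : Function.Surjective f := by
    rw [← AlgHom.range_eq_top]
    refine subalgebra_eq_top_of_tower P.adjoin_eq_top hgen ?_ ?_
    · rintro k (rfl | rfl)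
      exacts [⟨_, hfw⟩, ⟨_, hfs⟩]
    · rintro k (rfl | rfl | rfl)
      exacts [⟨_, hfx⟩, ⟨_, hf₁⟩, ⟨_, hf₂⟩]
  let I := TwoSidedIdeal.ker f
  let fl : I.ringCon.Quotient →ₐ[F] B := RingCon.liftₐ I.ringCon f fun _ _ hab => hab
  have hfl (a : GenClifford c.Φ) : fl (a : I.ringCon.Quotient) = f a := rfl
  have hbij : Function.Bijective fl := by
    constructor
    · intro a b hab
      induction a using Quotient.inductionOn'
      induction b using Quotient.inductionOn'
      exact Quotient.sound' hab
    · intro b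
      obtain ⟨a, rfl⟩ := hsurj b
      exact ⟨(a : I.ringCon.Quotient), rfl⟩
  let e := AlgEquiv.ofBijective fl hbij
  have hI : IsSimpleRing I.ringCon.Quotient := IsSimpleRing.of_ringEquiv e.symm.toRingEquiv ‹_›
  refine ⟨⟨I, hI⟩, ⟨e.symm.toAlgHom.comp (IsScalarTower.toAlgHom F P.field B), ?_, ?_, ?_⟩,
    ⟨e, hfw, hfs⟩, ?_⟩
  · intro k a
    apply e.injective
    rw [map_mul, map_mul]
    simp [Algebra.commutes]
  · exact e.symm_apply_eq.2 hfw.symm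
  · exact e.symm_apply_eq.2 hfs.symm
  · rintro J ⟨φ, hφ, hφR, hφS⟩
    let alg : Algebra P.field J.1.ringCon.Quotient := φ.toRingHom.toAlgebra' hφ
    have tower : IsScalarTower F P.field J.1.ringCon.Quotient :=
      IsScalarTower.of_algebraMap_eq fun r => (φ.commutes r).symm
    obtain ⟨hQ, hQy⟩ := isGradedTriple_map (quotientMap J) hρ h3 hα
    obtain ⟨g, hgx, hg₁, hg₂⟩ := huniv J.1.ringCon.Quotient _ _ _ hQ
      (by rw [← map_w, ← hφR, ← Algebra.algebraMap_eq_smul_one]; rfl)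
      (by rw [← map_pow, ← hφS, ← Algebra.algebraMap_eq_smul_one]; rfl)
    have hcomp : (g.restrictScalars F).comp f = quotientMap J := by
      refine AlgHom.ext_of_adjoin_eq_top adjoin_gen ?_
      rintro z (rfl | rfl)
      · simp [hfx, hgx]
      · rw [AlgHom.comp_apply, hfy, hQy, ← hgx, ← hg₁, ← hg₂]
        change g.restrictScalars F _ = _ + _ • g.restrictScalars F x
          + _ • (g.restrictScalars F x * g.restrictScalars F x)
          + g.restrictScalars F y₁ + g.restrictScalars F y₂
        simp only [y₀Of, map_add, map_smul, map_mul, map_one]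
    have := J.2
    have hginj : Function.Injective g := RingHom.injective g.toRingHom
    apply Subtype.ext
    change J.1 = TwoSidedIdeal.ker f
    rw [← ker_quotientMap J]
    ext a
    rw [TwoSidedIdeal.mem_ker, TwoSidedIdeal.mem_ker, ← hcomp]
    exact map_eq_zero_iff g hginj

end Point
end CubicCoeffs
end

/-! ### Symbol algebras as simple images, and the correspondence -/

section
namespace CubicCoeffs
namespace Point

variable {F : Type u} [Field F] {c : CubicCoeffs F} {ρ : F}

/-- For `S₀ ≠ 0` the symbol algebra `(α, S₀)`, with `x = u`, `y₁ = v` and `y₂ = h(x) y₁⁻¹`, is the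
simple image above `P`. -/
theorem exists_image_algOne (h3 : (3 : F) ≠ 0) (hρ : ρ ^ 2 + ρ + 1 = 0) (hα : c.α ≠ 0)
    (P : c.Point ρ) (hP : c.curveEq ρ P.R₀ P.S₀ = 0) (hS : P.S₀ ≠ 0)
    {ζ a : P.field} (hζ : ζ = algebraMap F P.field ρ) (ha : a = algebraMap F P.field c.α)
    [IsSimpleRing (SymbolAlgebra 3 ζ a P.S₀)] :
    ∃ I : SimpleImage (GenClifford c.Φ), P.LiesUnder I ∧ P.Yields I (SymbolAlgebra 3 ζ a P.S₀) ∧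
      ∀ J, P.LiesUnder J → J = I := by
  let x : SymbolAlgebra 3 ζ a P.S₀ := SymbolAlgebra.u 3 ζ a P.S₀
  let y₁ : SymbolAlgebra 3 ζ a P.S₀ := SymbolAlgebra.v 3 ζ a P.S₀
  have hx : x * (x * x) = c.α • (1 : SymbolAlgebra 3 ζ a P.S₀) := by
    rw [← algebraMap_smul P.field c.α, ← ha, ← SymbolAlgebra.u_pow, pow_succ, pow_two, mul_assoc]
  have hy₁ : y₁ * (y₁ * y₁) = P.S₀ • (1 : SymbolAlgebra 3 ζ a P.S₀) := by
    rw [← SymbolAlgebra.v_pow, pow_succ, pow_two, mul_assoc]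
  have h₁ : y₁ * x = ρ • (x * y₁) := by
    rw [← algebraMap_smul P.field ρ, ← hζ]; exact SymbolAlgebra.v_mul_u 3 ζ a P.S₀
  obtain ⟨h, hw, hs⟩ := isGradedTriple_of_S_ne_zero h3 hα hρ hP hS hx h₁ hy₁ rfl
  refine exists_image_of_model h3 hρ hα P h hw hs ?_ ?_
  · rw [eq_top_iff, ← SymbolAlgebra.adjoin_eq_top]
    refine Algebra.adjoin_mono ?_
    rintro z (rfl | rfl) <;> simp [x, y₁]
  · intro Q _ _ _ _ x' y₁' y₂' h' hw' hs'
    let g : SymbolAlgebra 3 ζ a P.S₀ →ₐ[P.field] Q := SymbolAlgebra.lift (U := x') (V := y₁')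
      (by rw [ha, algebraMap_smul, ← h'.cube, pow_succ, pow_two, mul_assoc]) hs'
      (by rw [hζ, algebraMap_smul, h'.mul₁])
    have hgx : g x = x' := SymbolAlgebra.lift_u ..
    have hgy : g y₁ = y₁' := SymbolAlgebra.lift_v ..
    refine ⟨g, hgx, hgy, ?_⟩
    have e := h'.y₂_mul_y₁_cube hα
    rw [hs', mul_smul_comm, mul_one, hw', mul_smul_comm, mul_one] at e
    rw [← algebraMap_smul P.field (c.p ρ) (x * x),
      ← algebraMap_smul P.field c.q (1 : SymbolAlgebra 3 ζ a P.S₀)]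
    simp only [map_smul, map_mul, map_sub, map_one, hgx, hgy]
    simp only [algebraMap_smul]
    rw [← e, smul_smul, inv_mul_cancel₀ hS, one_smul]

/-- For `S₀ = 0` the symbol algebra `(T, α)`, with `x = v`, `y₂ = u` and `y₁ = y₂⁻¹ h(x)`, is the
simple image above `P`. -/
theorem exists_image_algTwo (h3 : (3 : F) ≠ 0) (hρ : ρ ^ 2 + ρ + 1 = 0) (hα : c.α ≠ 0)
    (P : c.Point ρ) (hP : c.curveEq ρ P.R₀ P.S₀ = 0) (hS : P.S₀ = 0)
    {ζ a T : P.field} (hζ : ζ = algebraMap F P.field ρ) (ha : a = algebraMap F P.field c.α)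
    (hT : T = algebraMap F P.field (ρ ^ 2 * c.e) * P.R₀ - algebraMap F P.field c.D) (hT0 : T ≠ 0)
    [IsSimpleRing (SymbolAlgebra 3 ζ T a)] :
    ∃ I : SimpleImage (GenClifford c.Φ), P.LiesUnder I ∧ P.Yields I (SymbolAlgebra 3 ζ T a) ∧
      ∀ J, P.LiesUnder J → J = I := by
  let x : SymbolAlgebra 3 ζ T a := SymbolAlgebra.v 3 ζ T a
  let y₂ : SymbolAlgebra 3 ζ T a := SymbolAlgebra.u 3 ζ T a
  have hx : x * (x * x) = c.α • (1 : SymbolAlgebra 3 ζ T a) := by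
    rw [← algebraMap_smul P.field c.α, ← ha, ← SymbolAlgebra.v_pow, pow_succ, pow_two, mul_assoc]
  have hy₂ : y₂ * (y₂ * y₂) = T • (1 : SymbolAlgebra 3 ζ T a) := by
    rw [← SymbolAlgebra.u_pow, pow_succ, pow_two, mul_assoc]
  have h₂ : x * y₂ = ρ • (y₂ * x) := by
    rw [← algebraMap_smul P.field ρ, ← hζ]; exact SymbolAlgebra.v_mul_u 3 ζ T a
  obtain ⟨h, hw, hs⟩ := isGradedTriple_of_T_ne_zero h3 hα hρ hP (by rw [hS, sub_zero, hT]) hT0 hx h₂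
    hy₂ rfl
  refine exists_image_of_model h3 hρ hα P h hw hs ?_ ?_
  · rw [eq_top_iff, ← SymbolAlgebra.adjoin_eq_top]
    refine Algebra.adjoin_mono ?_
    rintro z (rfl | rfl) <;> simp [x, y₂]
  · intro Q _ _ _ _ x' y₁' y₂' h' hw' hs'
    have hρ3 : ρ * ρ ^ 2 = 1 := by linear_combination (ρ - 1) * hρ
    have hy₂' : y₂' ^ 3 = T • (1 : Q) := by
      rw [h'.y₂_cube, hs', hw', hS, zero_smul, sub_zero, ← algebraMap_smul P.field (ρ ^ 2 * c.e),
        ← algebraMap_smul P.field c.D, smul_smul, ← sub_smul, hT]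
    let g : SymbolAlgebra 3 ζ T a →ₐ[P.field] Q := SymbolAlgebra.lift (U := y₂') (V := x') hy₂'
      (by rw [ha, algebraMap_smul, ← h'.cube, pow_succ, pow_two, mul_assoc])
      (by rw [hζ, algebraMap_smul, h'.mul₂, smul_smul, hρ3, one_smul])
    have hgx : g x = x' := SymbolAlgebra.lift_v ..
    have hgy : g y₂ = y₂' := SymbolAlgebra.lift_u ..
    refine ⟨g, hgx, ?_, hgy⟩
    have e := h'.mul₂₁ hα
    rw [hw', mul_smul_comm, mul_one] at e
    rw [← algebraMap_smul P.field (c.p ρ) (x * x),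
      ← algebraMap_smul P.field c.q (1 : SymbolAlgebra 3 ζ T a)]
    simp only [map_smul, map_mul, map_sub, map_one, hgx, hgy]
    simp only [algebraMap_smul]
    rw [← e, ← mul_assoc, ← mul_assoc, ← pow_two, ← pow_succ, hy₂', smul_mul_assoc, one_mul,
      smul_smul, inv_mul_cancel₀ hT0, one_smul]

theorem curveEq_residue (P : c.Point ρ) : c.curveEq ρ P.R₀ P.S₀ = 0 := by
  apply P.field.val.injective
  rw [map_zero]
  have h : c.curveEq ρ P.R P.S = 0 := P.2
  rw [← h]
  simp only [curveEq, map_sub, map_mul, map_pow, map_add]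
  rfl

end Point
end CubicCoeffs
end

theorem theorem3p10 {F : Type*} [Field F] (ρ : F) (c : CubicCoeffs F)
    (hchar : ringChar F ≠ 3) (hρ : IsPrimitiveRoot ρ 3) (hα : c.α ≠ 0)
    (hΔ : (c.weierstrass ρ).Δ ≠ 0) (hD : c.D ≠ 0)
    (hx : IsField (AdjoinRoot (Polynomial.X ^ 3 - Polynomial.C c.α : Polynomial F))) :
    ∃ Θ : c.GaloisOrbit ρ ≃ SimpleImage (GenClifford c.Φ),
      ∀ P : c.Point ρ,
        (P.S₀ ≠ 0 →
          IsCentralSimple P.field P.algOne ∧ P.Yields (Θ P.orbit) P.algOne) ∧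
        (P.S₀ = 0 →
          algebraMap F P.field (ρ ^ 2 * c.e) * P.R₀ - algebraMap F P.field c.D ≠ 0 ∧
          IsCentralSimple P.field P.algTwo ∧ P.Yields (Θ P.orbit) P.algTwo) := by
  have h3 := three_ne_zero_of_isPrimitiveRoot hρ
  have hρ' := sq_add_self_add_one hρ
  have key (P : c.Point ρ) : ∃ I : SimpleImage (GenClifford c.Φ), P.LiesUnder I ∧
      (∀ J, P.LiesUnder J → J = I) ∧
      (P.S₀ ≠ 0 → IsCentralSimple P.field P.algOne ∧ P.Yields I P.algOne) ∧
      (P.S₀ = 0 →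
        algebraMap F P.field (ρ ^ 2 * c.e) * P.R₀ - algebraMap F P.field c.D ≠ 0 ∧
        IsCentralSimple P.field P.algTwo ∧ P.Yields I P.algTwo) := by
    have hP := P.curveEq_residue
    have hζ := sq_add_self_add_one (hρ.map_of_injective (algebraMap F P.field).injective)
    have h3' : (3 : P.field) ≠ 0 := by
      rw [← map_ofNat (algebraMap F P.field) 3]; exact (map_ne_zero _).2 h3
    have hα' := (map_ne_zero (algebraMap F P.field)).2 hα
    by_cases hS : P.S₀ = 0
    · have hT := CubicCoeffs.linear_ne_zero_of_S_eq_zero h3 hα hρ' hD hx hP hS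
      have hcs : IsCentralSimple P.field P.algTwo :=
        SymbolAlgebra.isCentralSimple_three hζ h3' hT hα'
      have := hcs.2.1
      obtain ⟨I, hI, hY, hU⟩ := P.exists_image_algTwo h3 hρ' hα hP hS rfl rfl rfl hT
      exact ⟨I, hI, hU, fun h => absurd hS h, fun _ => ⟨hT, hcs, hY⟩⟩
    · have hcs : IsCentralSimple P.field P.algOne :=
        SymbolAlgebra.isCentralSimple_three hζ h3' hα' hS
      have := hcs.2.1
      obtain ⟨I, hI, hY, hU⟩ := P.exists_image_algOne h3 hρ' hα hP hS rfl rfl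
      exact ⟨I, hI, hU, fun _ => ⟨hcs, hY⟩, fun h => absurd h hS⟩
  choose I hI hU hY using key
  let θ : c.GaloisOrbit ρ → SimpleImage (GenClifford c.Φ) :=
    Quotient.lift I fun P P' h => hU P' _ ((hI P).of_orbit_eq (Quotient.sound h))
  refine ⟨Equiv.ofBijective θ ⟨?_, ?_⟩, hY⟩
  · intro o o'
    induction o using Quotient.inductionOn with | _ P
    induction o' using Quotient.inductionOn with | _ P'
    intro h
    have h' : I P = I P' := h
    exact (hI P).orbit_eq (h' ▸ hI P')
  · intro J
    obtain ⟨P, hP⟩ := CubicCoeffs.Point.exists_liesUnder h3 hρ' hα J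
    exact ⟨P.orbit, (hU P J hP).symm⟩
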